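/- **Theorem (Bayesian quantum Cramér–Rao bound, modified purification).** Let $\mathcal H_A,\mathcal H_B$ be complex Hilbert spaces (of any dimension), $\mathcal H=\mathcal H_A\otimes\mathcal H_B$ their Hilbert space tensor product, $|\Psi\rangle\in\mathcal H$ a unit vector, $(U_x)_{x\in\mathbb R^n}$ a family of unitaries on $\mathcal H$, and $(U_B(x))_{x\in\mathbb R^n}$ an arbitrary family of unitaries on $\mathcal H_B$. Let $E_A$ be a POVM on $\mathcal H_A$ with outcomes in a measurable space $Y$, so that the likelihood of the observation $y$ given the parameter $x$ is $$P(dy|x)=\mathrm{tr}\{[E_A(dy)\otimes 1_B]\,U_x|\Psi\rangle\langle\Psi|U_x^\dagger\},$$ and let $\tilde x:Y\to\mathbb R^n$ be any measurable estimator. Put $$\rho_x=(1_A\otimes U_B(x)^\dagger)\,U_x|\Psi\rangle\langle\Psi|U_x^\dagger\,(1_A\otimes U_B(x)),\qquad F(\rho_x,\rho_{x'})=\bigl|\langle\Psi|U_{x'}^\dagger\,(1_A\otimes U_B(x')U_B(x)^\dagger)\,U_x|\Psi\rangle\bigr|^2 .$$ Let $P$ be a (Fréchet) differentiable prior probability density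 on $\mathbb R^n$. Assume that at every $x$ with $P(x)>0$ the map $x\mapsto\rho_x$ is differentiable in operator norm and $x'\mapsto F(\rho_x,\rho_{x'})$ is twice (Fréchet) differentiable at $x'=x$; that the integrals $$J^{(Q)}_{jk}=-2\int dx\,P(x)\,\frac{\partial^2F(\rho_x,\rho_{x'})}{\partial x_j'\,\partial x_k'}\Big|_{x'=x},\qquad J^{(C)}_{jk}=\int dx\,P(x)\,\frac{\partial\ln P(x)}{\partial x_j}\frac{\partial\ln P(x)}{\partial x_k}$$ converge absolutely (the integrands being $0$ where $P(x)=0$); and that every mean-square error $\int dx\,P(x)\int P(dy|x)\,(\tilde x_j(y)-x_j)^2$ is finite. Then $J^{(Q)}+J^{(C)}$ is positive definite, hence invertible, and the error covariance matrix $$\Sigma=\int dx\,P(x)\int P(dy|x)\,(\tilde x(y)-x)(\tilde x(y)-x)^\top$$ satisfies the matrix inequality (in the positive semidefinite order) $$\Sigma\ \ge\ \bigl(J^{(Q)}+J^{(C)}\bigr)^{-1}.$$ -/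

import Mathlib

noncomputable section

open MeasureTheory
open scoped TensorProduct

namespace QuantumEstimation

/-! ### The composite Hilbert space and product operators -/

section Tensor

variable (A B : Type*) [NormedAddCommGroup A] [InnerProductSpace ℂ A]
  [NormedAddCommGroup B] [InnerProductSpace ℂ B]

/-- The Hilbert space tensor product of `A` and `B`: the completion of the algebraic tensor
product for the inner product with `⟪a ⊗ b, a' ⊗ b'⟫ = ⟪a, a'⟫ * ⟪b, b'⟫`. -/
abbrev HilbertTensor : Type _ := UniformSpace.Completion (A ⊗[ℂ] B)

variable {A B}

/-- The bounded operator `S ⊗ T` on the Hilbert space tensor product. -/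
def tensorOp (S : A →L[ℂ] A) (T : B →L[ℂ] B) : HilbertTensor A B →L[ℂ] HilbertTensor A B :=
  (TensorProduct.mapL S T).completion

theorem tensorOp_coe (S : A →L[ℂ] A) (T : B →L[ℂ] B) (z : A ⊗[ℂ] B) :
    tensorOp S T (z : HilbertTensor A B) = (TensorProduct.mapL S T z : A ⊗[ℂ] B) :=
  ContinuousLinearMap.completion_apply_coe _ _

theorem tensorOp_ext {X Y : HilbertTensor A B →L[ℂ] HilbertTensor A B}
    (h : ∀ z : A ⊗[ℂ] B, X (z : HilbertTensor A B) = Y (z : HilbertTensor A B)) : X = Y := by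
  ext z
  induction z using UniformSpace.Completion.induction_on with
  | hp => exact isClosed_eq X.continuous Y.continuous
  | ih z => exact h z

theorem tensorOp_mul (S S' : A →L[ℂ] A) (T T' : B →L[ℂ] B) :
    tensorOp (S * S') (T * T') = tensorOp S T * tensorOp S' T' := by
  apply tensorOp_ext
  intro z
  simp only [mul_apply_eq_comp, tensorOp_coe, TensorProduct.mapL_mul]

theorem tensorOp_one : tensorOp (1 : A →L[ℂ] A) (1 : B →L[ℂ] B) = 1 := by
  apply tensorOp_ext
  intro z
  rw [tensorOp_coe]
  congr 1
  exact congrArg (fun f => f z) (TensorProduct.mapL_id_id (𝕜 := ℂ) (E := A) (G := B))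

theorem tensorOp_add_left (S S' : A →L[ℂ] A) (T : B →L[ℂ] B) :
    tensorOp (S + S') T = tensorOp S T + tensorOp S' T := by
  apply tensorOp_ext
  intro z
  simp only [add_apply, tensorOp_coe, TensorProduct.mapL_add_left,
    UniformSpace.Completion.coe_add]

theorem inner_tensorOp [CompleteSpace A] [CompleteSpace B] (S : A →L[ℂ] A) (T : B →L[ℂ] B)
    (z w : HilbertTensor A B) :
    inner ℂ (tensorOp S T z) w = inner ℂ z (tensorOp (star S) (star T) w) := by
  induction z, w using UniformSpace.Completion.induction_on₂ with
  | hp =>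
    apply isClosed_eq
    · exact ((tensorOp S T).continuous.comp continuous_fst).inner continuous_snd
    · exact continuous_fst.inner ((tensorOp (star S) (star T)).continuous.comp continuous_snd)
  | ih z w =>
    rw [tensorOp_coe, tensorOp_coe, UniformSpace.Completion.inner_coe,
      UniformSpace.Completion.inner_coe]
    induction z using TensorProduct.induction_on with
    | zero => simp
    | add z z' hz hz' => rw [map_add, inner_add_left, inner_add_left, hz, hz']
    | tmul a b =>
      induction w using TensorProduct.induction_on with
      | zero => simp
      | add w w' hw hw' => rw [map_add, inner_add_right, inner_add_right, hw, hw']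
      | tmul a' b' =>
        simp only [TensorProduct.mapL_tmul, TensorProduct.inner_tmul,
          ContinuousLinearMap.star_eq_adjoint, ContinuousLinearMap.adjoint_inner_right]

theorem star_tensorOp [CompleteSpace A] [CompleteSpace B] (S : A →L[ℂ] A) (T : B →L[ℂ] B) :
    star (tensorOp S T) = tensorOp (star S) (star T) := by
  rw [ContinuousLinearMap.star_eq_adjoint, eq_comm, ContinuousLinearMap.eq_adjoint_iff]
  intro z w
  rw [inner_tensorOp, star_star, star_star]

theorem isPositive_tensorOp_one [CompleteSpace A] [CompleteSpace B] {S : A →L[ℂ] A}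
    (hS : S.IsPositive) : (tensorOp S (1 : B →L[ℂ] B)).IsPositive := by
  have h0 : 0 ≤ S := (ContinuousLinearMap.nonneg_iff_isPositive S).2 hS
  obtain ⟨R, rfl⟩ := CStarAlgebra.nonneg_iff_eq_star_mul_self.1 h0
  have h := tensorOp_mul (star R) R (1 : B →L[ℂ] B) 1
  rw [mul_one] at h
  rw [h]
  have h2 := star_tensorOp R (1 : B →L[ℂ] B)
  rw [star_one] at h2
  rw [← h2, ← ContinuousLinearMap.nonneg_iff_isPositive]
  exact star_mul_self_nonneg _

end Tensor

/-! ### Measurements -/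

/-- A positive operator-valued measure on the Hilbert space `K` with outcomes in `Y`: positive
operators, normalised, and countably additive in the weak operator topology. -/
structure POVM (Y : Type*) [MeasurableSpace Y] (K : Type*) [NormedAddCommGroup K]
    [InnerProductSpace ℂ K] where
  /-- The effect of an event. -/
  effect : Set Y → K →L[ℂ] K
  isPositive : ∀ s, MeasurableSet s → (effect s).IsPositive
  effect_univ : effect Set.univ = 1
  hasSum_effect : ∀ s : ℕ → Set Y, (∀ i, MeasurableSet (s i)) →
    Pairwise (Function.onFun Disjoint s) → ∀ a b : K,
      HasSum (fun i => inner ℂ a (effect (s i) b)) (inner ℂ a (effect (⋃ i, s i) b))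

namespace POVM

variable {Y : Type*} [MeasurableSpace Y] {K : Type*} [NormedAddCommGroup K]
  [InnerProductSpace ℂ K] (M : POVM Y K)

theorem effect_empty : M.effect ∅ = 0 := by
  ext b
  refine ext_inner_left ℂ fun a => ?_
  have h := M.hasSum_effect (fun _ => ∅) (fun _ => MeasurableSet.empty)
    (fun i j _ => by simp [Function.onFun]) a b
  have h2 := h.summable.tendsto_atTop_zero
  simpa using tendsto_nhds_unique tendsto_const_nhds h2

theorem re_nonneg {s : Set Y} (hs : MeasurableSet s) (a : K) :
    0 ≤ (inner ℂ a (M.effect s a)).re :=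
  (M.isPositive s hs).re_inner_nonneg_right a

/-- The distribution of the outcome when the POVM `M` is measured in the pure state with state
vector `φ`: the event `s` has probability `tr (M(s) |φ⟩⟨φ|) = ⟪φ, M(s) φ⟫`. -/
def outcome (φ : K) : Measure Y :=
  Measure.ofMeasurable (fun s _ => ENNReal.ofReal (inner ℂ φ (M.effect s φ)).re)
    (by simp [M.effect_empty])
    (by
      intro s hs hd
      have h := (Complex.hasSum_iff _ _).1 (M.hasSum_effect s hs hd φ φ) |>.1
      rw [← h.tsum_eq]
      exact ENNReal.ofReal_tsum_of_nonneg (fun i => M.re_nonneg (hs i) φ) h.summable)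

theorem outcome_apply (φ : K) {s : Set Y} (hs : MeasurableSet s) :
    M.outcome φ s = ENNReal.ofReal (inner ℂ φ (M.effect s φ)).re :=
  Measure.ofMeasurable_apply s hs

theorem effect_union {s t : Set Y} (hs : MeasurableSet s) (ht : MeasurableSet t)
    (hd : Disjoint s t) : M.effect (s ∪ t) = M.effect s + M.effect t := by
  ext b
  refine ext_inner_left ℂ fun a => ?_
  let f : ℕ → Set Y := fun i => if i = 0 then s else if i = 1 then t else ∅
  have hf : ∀ i, MeasurableSet (f i) := by
    intro i
    simp only [f]
    split_ifs
    exacts [hs, ht, MeasurableSet.empty]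
  have hfd : Pairwise (Function.onFun Disjoint f) := by
    intro i j hij
    simp only [Function.onFun, f]
    split_ifs <;> simp_all [hd.symm]
  have hU : (⋃ i, f i) = s ∪ t := by
    ext y
    simp only [Set.mem_iUnion, Set.mem_union, f]
    constructor
    · rintro ⟨i, hi⟩
      split_ifs at hi
      exacts [Or.inl hi, Or.inr hi, absurd hi (Set.notMem_empty y)]
    · rintro (h | h)
      exacts [⟨0, by simpa using h⟩, ⟨1, by simpa using h⟩]
  have h1 := M.hasSum_effect f hf hfd a b
  rw [hU] at h1
  have h2 : HasSum (fun i => inner ℂ a (M.effect (f i) b))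
      (∑ i ∈ ({0, 1} : Finset ℕ), inner ℂ a (M.effect (f i) b)) := by
    apply hasSum_sum_of_ne_finset_zero
    intro i hi
    simp only [Finset.mem_insert, Finset.mem_singleton, not_or] at hi
    simp [f, hi.1, hi.2, M.effect_empty]
  rw [h1.unique h2]
  simp [f, inner_add_right]

theorem effect_biUnion {s : ℕ → Set Y} (hs : ∀ i, MeasurableSet (s i))
    (hd : Pairwise (Function.onFun Disjoint s)) (F : Finset ℕ) :
    M.effect (⋃ i ∈ F, s i) = ∑ i ∈ F, M.effect (s i) := by
  classical
  induction F using Finset.induction_on with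
  | empty => simp [M.effect_empty]
  | insert i F hi ih =>
    rw [Finset.set_biUnion_insert, Finset.sum_insert hi, M.effect_union (hs i)
      (Finset.measurableSet_biUnion F fun j _ => hs j), ih]
    rw [Set.disjoint_iUnion₂_right]
    intro j hj
    exact hd (fun h => hi (h ▸ hj))

theorem norm_effect_le [CompleteSpace K] {s : Set Y} (hs : MeasurableSet s) :
    ‖M.effect s‖ ≤ 1 := by
  have h0 : 0 ≤ M.effect s :=
    (ContinuousLinearMap.nonneg_iff_isPositive _).2 (M.isPositive s hs)
  have h1 : 0 ≤ M.effect sᶜ :=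
    (ContinuousLinearMap.nonneg_iff_isPositive _).2 (M.isPositive _ hs.compl)
  have h2 := M.effect_union hs hs.compl disjoint_compl_right
  rw [Set.union_compl_self, M.effect_univ] at h2
  rw [CStarAlgebra.norm_le_one_iff_of_nonneg _ h0, h2]
  exact le_add_of_nonneg_right h1

end POVM

section Ancilla

variable {Y : Type*} [MeasurableSpace Y] {A B : Type*} [NormedAddCommGroup A]
  [InnerProductSpace ℂ A] [NormedAddCommGroup B] [InnerProductSpace ℂ B]

theorem norm_tensorOp_one_le {S : A →L[ℂ] A} (hS : ‖S‖ ≤ 1) (z : HilbertTensor A B) :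
    ‖tensorOp S (1 : B →L[ℂ] B) z‖ ≤ ‖z‖ := by
  induction z using UniformSpace.Completion.induction_on with
  | hp => exact isClosed_le (tensorOp S 1).continuous.norm continuous_norm
  | ih z =>
    rw [tensorOp_coe, UniformSpace.Completion.norm_coe, UniformSpace.Completion.norm_coe]
    have h1 : ‖(1 : B →L[ℂ] B)‖ ≤ 1 := ContinuousLinearMap.norm_id_le
    calc _ ≤ ‖TensorProduct.mapL S (1 : B →L[ℂ] B)‖ * ‖z‖ := ContinuousLinearMap.le_opNorm _ _
      _ ≤ 1 * ‖z‖ := by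
        gcongr
        exact (TensorProduct.norm_mapL_le _ _).trans (mul_le_one₀ hS (norm_nonneg _) h1)
      _ = ‖z‖ := one_mul _

theorem hasSum_inner_tensorOp [CompleteSpace A] (M : POVM Y A) {s : ℕ → Set Y}
    (hs : ∀ i, MeasurableSet (s i)) (hd : Pairwise (Function.onFun Disjoint s))
    (z w : HilbertTensor A B) :
    HasSum (fun i => inner ℂ z (tensorOp (M.effect (s i)) (1 : B →L[ℂ] B) w))
      (inner ℂ z (tensorOp (M.effect (⋃ i, s i)) (1 : B →L[ℂ] B) w)) := by
  have hfin : ∀ (F : Finset ℕ) (z w : HilbertTensor A B),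
      ∑ i ∈ F, inner ℂ z (tensorOp (M.effect (s i)) (1 : B →L[ℂ] B) w) =
        inner ℂ z (tensorOp (M.effect (⋃ i ∈ F, s i)) (1 : B →L[ℂ] B) w) := by
    classical
    intro F z w
    rw [M.effect_biUnion hs hd]
    induction F using Finset.induction_on with
    | empty =>
      have h0 : tensorOp (0 : A →L[ℂ] A) (1 : B →L[ℂ] B) = 0 := by
        have h := tensorOp_add_left (0 : A →L[ℂ] A) 0 (1 : B →L[ℂ] B)
        rw [add_zero] at h
        exact left_eq_add.1 h
      simp [h0]
    | insert i F hi ih =>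
      rw [Finset.sum_insert hi, Finset.sum_insert hi, tensorOp_add_left, add_apply,
        inner_add_right, ih]
  have halg : ∀ z w : A ⊗[ℂ] B,
      HasSum (fun i => inner ℂ (z : HilbertTensor A B)
          (tensorOp (M.effect (s i)) (1 : B →L[ℂ] B) w))
        (inner ℂ (z : HilbertTensor A B) (tensorOp (M.effect (⋃ i, s i)) (1 : B →L[ℂ] B) w)) := by
    intro z w
    simp only [tensorOp_coe, UniformSpace.Completion.inner_coe]
    induction z using TensorProduct.induction_on with
    | zero => simp
    | add z z' hz hz' => simpa only [inner_add_left] using hz.add hz'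
    | tmul a b =>
      induction w using TensorProduct.induction_on with
      | zero => simp
      | add w w' hw hw' => simpa only [map_add, inner_add_right] using hw.add hw'
      | tmul a' b' =>
        simp only [TensorProduct.mapL_tmul, TensorProduct.inner_tmul]
        exact (M.hasSum_effect s hs hd a a').mul_right _
  have hb : ∀ (t : Set Y), MeasurableSet t → ∀ z w z₀ w₀ : HilbertTensor A B,
      ‖inner ℂ z (tensorOp (M.effect t) (1 : B →L[ℂ] B) w) -
        inner ℂ z₀ (tensorOp (M.effect t) (1 : B →L[ℂ] B) w₀)‖ ≤
          ‖z - z₀‖ * ‖w‖ + ‖z₀‖ * ‖w - w₀‖ := by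
    intro t ht z w z₀ w₀
    have e : inner ℂ z (tensorOp (M.effect t) (1 : B →L[ℂ] B) w) -
        inner ℂ z₀ (tensorOp (M.effect t) (1 : B →L[ℂ] B) w₀) =
        inner ℂ (z - z₀) (tensorOp (M.effect t) (1 : B →L[ℂ] B) w) +
          inner ℂ z₀ (tensorOp (M.effect t) (1 : B →L[ℂ] B) (w - w₀)) := by
      rw [map_sub, inner_sub_left, inner_sub_right]
      ring
    rw [e]
    refine (norm_add_le _ _).trans (add_le_add ?_ ?_)
    · exact (norm_inner_le_norm _ _).trans
        (by gcongr; exact norm_tensorOp_one_le (M.norm_effect_le ht) _)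
    · exact (norm_inner_le_norm _ _).trans
        (by gcongr; exact norm_tensorOp_one_le (M.norm_effect_le ht) _)
  rw [HasSum, SummationFilter.unconditional_filter, Metric.tendsto_atTop]
  intro ε hε
  have hcont : Filter.Tendsto (fun q : HilbertTensor A B × HilbertTensor A B =>
      ‖z - q.1‖ * ‖w‖ + ‖q.1‖ * ‖w - q.2‖) (nhds (z, w)) (nhds 0) := by
    have : Continuous (fun q : HilbertTensor A B × HilbertTensor A B =>
      ‖z - q.1‖ * ‖w‖ + ‖q.1‖ * ‖w - q.2‖) := by fun_prop
    simpa using this.tendsto (z, w)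
  have hdense : DenseRange (fun q : (A ⊗[ℂ] B) × (A ⊗[ℂ] B) =>
      ((q.1 : HilbertTensor A B), (q.2 : HilbertTensor A B))) :=
    UniformSpace.Completion.denseRange_coe.prodMap UniformSpace.Completion.denseRange_coe
  have hev := (hcont.eventually (gt_mem_nhds (show (0 : ℝ) < ε / 3 by positivity)))
  obtain ⟨U, hU, hUo, hzU⟩ := eventually_nhds_iff.1 hev
  obtain ⟨⟨z₀, w₀⟩, hq⟩ := hdense.exists_mem_open hUo ⟨_, hzU⟩
  have hq := hU _ hq
  have h0 := halg z₀ w₀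
  rw [HasSum, SummationFilter.unconditional_filter, Metric.tendsto_atTop] at h0
  obtain ⟨N, hN⟩ := h0 (ε / 3) (by positivity)
  refine ⟨N, fun F hF => ?_⟩
  have h1 := hN F hF
  rw [hfin] at h1 ⊢
  have h2 := hb (⋃ i ∈ F, s i) (Finset.measurableSet_biUnion F fun j _ => hs j) z w z₀ w₀
  have h3 := hb (⋃ i, s i) (MeasurableSet.iUnion hs) z w z₀ w₀
  rw [← dist_eq_norm] at h2 h3
  rw [dist_comm] at h3
  have h4 := dist_triangle4 (inner ℂ z (tensorOp (M.effect (⋃ i ∈ F, s i)) (1 : B →L[ℂ] B) w))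
    (inner ℂ (z₀ : HilbertTensor A B)
      (tensorOp (M.effect (⋃ i ∈ F, s i)) (1 : B →L[ℂ] B) (w₀ : HilbertTensor A B)))
    (inner ℂ (z₀ : HilbertTensor A B)
      (tensorOp (M.effect (⋃ i, s i)) (1 : B →L[ℂ] B) (w₀ : HilbertTensor A B)))
    (inner ℂ z (tensorOp (M.effect (⋃ i, s i)) (1 : B →L[ℂ] B) w))
  linarith

/-- The POVM `s ↦ E_A(s) ⊗ 1_B` on the composite system. -/
def POVM.tensorOne [CompleteSpace A] (M : POVM Y A) (B : Type*) [NormedAddCommGroup B]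
    [InnerProductSpace ℂ B] [CompleteSpace B] : POVM Y (HilbertTensor A B) where
  effect s := tensorOp (M.effect s) 1
  isPositive s hs := isPositive_tensorOp_one (M.isPositive s hs)
  effect_univ := by rw [M.effect_univ, tensorOp_one]
  hasSum_effect _ hs hd z w := hasSum_inner_tensorOp M hs hd z w

end Ancilla

/-! ### The Bayesian estimation problem -/

section Estimation

variable {A B : Type*} [NormedAddCommGroup A] [InnerProductSpace ℂ A] [CompleteSpace A]
  [NormedAddCommGroup B] [InnerProductSpace ℂ B] [CompleteSpace B]
  {Y : Type*} [MeasurableSpace Y] {n : ℕ}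

/-- The partial derivative `∂f/∂x_j`. -/
def partialDeriv (j : Fin n) (f : (Fin n → ℝ) → ℝ) (x : Fin n → ℝ) : ℝ :=
  lineDeriv ℝ f x (Pi.single j 1)

/-- The likelihood `P(dy|x) = tr {[E_A(dy) ⊗ 1_B] U_x |Ψ⟩⟨Ψ| U_x†}`. -/
def likelihood (E : POVM Y A) (Ψ : HilbertTensor A B)
    (U : (Fin n → ℝ) → unitary (HilbertTensor A B →L[ℂ] HilbertTensor A B))
    (x : Fin n → ℝ) : Measure Y :=
  (E.tensorOne B).outcome ((U x : HilbertTensor A B →L[ℂ] HilbertTensor A B) Ψ)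

/-- The state vector `(1_A ⊗ U_B(x)†) U_x |Ψ⟩` of the modified purification. -/
def purifiedVector (Ψ : HilbertTensor A B)
    (U : (Fin n → ℝ) → unitary (HilbertTensor A B →L[ℂ] HilbertTensor A B))
    (V : (Fin n → ℝ) → unitary (B →L[ℂ] B)) (x : Fin n → ℝ) : HilbertTensor A B :=
  tensorOp 1 (star (V x : B →L[ℂ] B)) ((U x : HilbertTensor A B →L[ℂ] HilbertTensor A B) Ψ)

/-- The purified density operator
`ρ_x = (1_A ⊗ U_B(x)†) U_x |Ψ⟩⟨Ψ| U_x† (1_A ⊗ U_B(x))`, a rank-one projection. -/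
def purifiedState (Ψ : HilbertTensor A B)
    (U : (Fin n → ℝ) → unitary (HilbertTensor A B →L[ℂ] HilbertTensor A B))
    (V : (Fin n → ℝ) → unitary (B →L[ℂ] B)) (x : Fin n → ℝ) :
    HilbertTensor A B →L[ℂ] HilbertTensor A B :=
  InnerProductSpace.rankOne ℂ (purifiedVector Ψ U V x) (purifiedVector Ψ U V x)

/-- The fidelity `F(ρ_x, ρ_x') = |⟨Ψ| U_x'† U_B(x') U_B(x)† U_x |Ψ⟩|²` of the purified states. -/
def purifiedFidelity (Ψ : HilbertTensor A B)
    (U : (Fin n → ℝ) → unitary (HilbertTensor A B →L[ℂ] HilbertTensor A B))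
    (V : (Fin n → ℝ) → unitary (B →L[ℂ] B)) (x x' : Fin n → ℝ) : ℝ :=
  ‖inner ℂ (purifiedVector Ψ U V x') (purifiedVector Ψ U V x)‖ ^ 2

/-- The second partial derivative `∂²F(ρ_x, ρ_x')/∂x'_j ∂x'_k` at `x' = x`. -/
def fidelityHessian (Ψ : HilbertTensor A B)
    (U : (Fin n → ℝ) → unitary (HilbertTensor A B →L[ℂ] HilbertTensor A B))
    (V : (Fin n → ℝ) → unitary (B →L[ℂ] B)) (x : Fin n → ℝ) (j k : Fin n) : ℝ :=
  partialDeriv j (partialDeriv k (purifiedFidelity Ψ U V x)) x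

/-- `J^(Q)_jk = -2 ∫ dx P(x) ∂²F(ρ_x, ρ_x')/∂x'_j ∂x'_k |_{x' = x}`. -/
def quantumInfo (p : (Fin n → ℝ) → ℝ) (Ψ : HilbertTensor A B)
    (U : (Fin n → ℝ) → unitary (HilbertTensor A B →L[ℂ] HilbertTensor A B))
    (V : (Fin n → ℝ) → unitary (B →L[ℂ] B)) : Matrix (Fin n) (Fin n) ℝ :=
  Matrix.of fun j k => -2 * ∫ x, p x * fidelityHessian Ψ U V x j k

/-- The integrand `P(x) (∂ ln P(x)/∂x_j) (∂ ln P(x)/∂x_k)`; it is `0` where `P(x) = 0`. -/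
def priorInfoDensity (p : (Fin n → ℝ) → ℝ) (j k : Fin n) (x : Fin n → ℝ) : ℝ :=
  p x * partialDeriv j (fun z => Real.log (p z)) x * partialDeriv k (fun z => Real.log (p z)) x

/-- The prior Fisher information matrix `J^(C)`. -/
def priorInfo (p : (Fin n → ℝ) → ℝ) : Matrix (Fin n) (Fin n) ℝ :=
  Matrix.of fun j k => ∫ x, priorInfoDensity p j k x

/-- The error covariance matrix
`Σ_jk = ∫ dx P(x) ∫ P(dy|x) (x̃_j(y) - x_j) (x̃_k(y) - x_k)`. -/
def errorCovariance (p : (Fin n → ℝ) → ℝ) (L : (Fin n → ℝ) → Measure Y)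
    (est : Y → Fin n → ℝ) : Matrix (Fin n) (Fin n) ℝ :=
  Matrix.of fun j k => ∫ x, p x * ∫ y, (est y j - x j) * (est y k - x k) ∂(L x)

/-- The mean-square error `∫ dx P(x) ∫ P(dy|x) (x̃_j(y) - x_j)²` of the `j`th parameter, as an
extended nonnegative number. -/
def meanSquareError (p : (Fin n → ℝ) → ℝ) (L : (Fin n → ℝ) → Measure Y)
    (est : Y → Fin n → ℝ) (j : Fin n) : ENNReal :=
  ∫⁻ x, ENNReal.ofReal (p x) * ∫⁻ y, ENNReal.ofReal ((est y j - x j) ^ 2) ∂(L x)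

end Estimation

end QuantumEstimation

end

/-! A unitary on the second factor commutes with E_A(dy) ⊗ 1, so the likelihood is also that of the
unit vectors φ_x = `purifiedVector`. The problem becomes one about a pure-state family in which ρ_x,
but not necessarily φ_x with its arbitrary phase, is differentiable. The phase is removed by working
with z(x') = ρ_x' φ_x = |φ_x'⟩⟨φ_x'|φ_x⟩ (`overlapVector`). If Z is its derivative at x' = x,
Pythagoras gives 1 - F = ‖z(x') - φ_x‖², hence -2 ∂_v²F = 4‖Zv‖² (`fderiv_fderiv_fidelity_self`),
and ⟨φ, Mφ⟩ has derivative 2 Re⟨φ_x, M Zv⟩ (`hasFDerivAt_re_inner_map`).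

The bound is then a Van Trees argument in which Cauchy–Schwarz is kept as a nonnegative quadratic
form. For a finitely valued estimator with joint densities K_r = p⟨φ, M_r φ⟩, positivity of the
effects gives, pointwise and for all real weights, Σ c_r² K_r + 2 Σ c_r ∂_v K_r + Q ≥ 0, with Q =
`infoDensity` (`sum_sq_add_score_nonneg`). With c_r = r - l(x) and an integration by parts this
becomes E(b - l)² + 2 l(v) + ∫ Q ≥ 0 (`score_nonneg`). To justify the integrations, the error is
first passed through a bounded function ψ, then simple estimators are replaced by measurable ones,
and finally ψ tends to the identity.

For b = u·x̃ and l(x) = u·x this says uᵀΣu + 2 u·v + vᵀJv ≥ 0 for all u and v, and a Schur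
complement gives both conclusions (`posDef_and_posSemidef_sub_inv`). -/

noncomputable section

open MeasureTheory
open scoped TensorProduct

namespace QuantumEstimation

/-! ### Differential geometry of pure-state families without a choice of phase -/

section PureState

open Filter Topology

/-- Second-order Taylor expansion in one variable, for a function that is twice differentiable at
`0` only. -/
theorem tendsto_div_sq_of_hasDerivAt {g g' : ℝ → ℝ} {c : ℝ}
    (hg : ∀ᶠ t in 𝓝 0, HasDerivAt g (g' t) t) (hg' : HasDerivAt g' c 0) (h0 : g 0 = 0)
    (h0' : g' 0 = 0) : Tendsto (fun t => g t / t ^ 2) (𝓝[≠] 0) (𝓝 (c / 2)) := by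
  have hs := hg'.tendsto_slope_zero
  refine HasDerivAt.lhopital_zero_nhdsNE (f' := g') (g' := fun t => 2 * t)
    (hg.filter_mono nhdsWithin_le_nhds) ?_ ?_ ?_ ?_ ?_
  · exact Eventually.of_forall fun t => by simpa using hasDerivAt_pow 2 t
  · filter_upwards [self_mem_nhdsWithin] with t ht
    exact mul_ne_zero two_ne_zero ht
  · have := hg.self_of_nhds.continuousAt.tendsto
    rw [h0] at this
    exact this.mono_left nhdsWithin_le_nhds
  · have : Tendsto (fun t : ℝ => t ^ 2) (𝓝 0) (𝓝 (0 ^ 2)) := (continuous_pow 2).tendsto 0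
    rw [zero_pow two_ne_zero] at this
    exact this.mono_left nhdsWithin_le_nhds
  · refine (hs.div_const 2).congr fun t => ?_
    simp only [zero_add, h0', sub_zero, smul_eq_mul]
    rw [inv_mul_eq_div, div_div, mul_comm]

variable {X : Type*} {H : Type*} [NormedAddCommGroup H] [InnerProductSpace ℂ H]

/-- The image `|φ_x'⟩⟨φ_x'|φ_x⟩` of `φ_x` under the projection onto `φ_x'`. -/
def overlapVector (φ : X → H) (x x' : X) : H := inner ℂ (φ x') (φ x) • φ x'

/-- The fidelity `|⟨φ_x'|φ_x⟩|²` of a family of state vectors. -/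
def fidelity (φ : X → H) (x x' : X) : ℝ := ‖inner ℂ (φ x') (φ x)‖ ^ 2

variable {φ : X → H} (hφ : ∀ x, ‖φ x‖ = 1)

include hφ in
theorem inner_self_of_unit (x : X) : inner ℂ (φ x) (φ x) = 1 := by
  rw [inner_self_eq_norm_sq_to_K, hφ]; simp

include hφ in
theorem overlapVector_self (x : X) : overlapVector φ x x = φ x := by
  rw [overlapVector, inner_self_of_unit hφ, one_smul]

theorem inner_overlapVector (φ : X → H) (x x' : X) :
    inner ℂ (φ x) (overlapVector φ x x') = (fidelity φ x x' : ℂ) := by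
  rw [overlapVector, inner_smul_right, ← inner_conj_symm (φ x), Complex.mul_conj, fidelity,
    Complex.normSq_eq_norm_sq]

theorem fidelity_eq_re (φ : X → H) (x x' : X) :
    fidelity φ x x' = (inner ℂ (φ x) (overlapVector φ x x')).re := by
  rw [inner_overlapVector, Complex.ofReal_re]

include hφ in
theorem fidelity_self (x : X) : fidelity φ x x = 1 := by
  rw [fidelity, inner_self_of_unit hφ]; simp

include hφ in
theorem fidelity_le_one (x x' : X) : fidelity φ x x' ≤ 1 := by
  have h := norm_inner_le_norm (𝕜 := ℂ) (φ x') (φ x)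
  rw [hφ, hφ, one_mul] at h
  exact pow_le_one₀ (norm_nonneg _) h

-- Pythagoras for the projection of `φ x` onto the line of `φ x'`. It turns second-order information
-- on the fidelity into first-order information on `overlapVector`.
include hφ in
theorem norm_overlapVector_sub_sq (x x' : X) :
    ‖overlapVector φ x x' - φ x‖ ^ 2 = 1 - fidelity φ x x' := by
  rw [norm_sub_sq (𝕜 := ℂ), ← inner_conj_symm, inner_overlapVector, Complex.conj_ofReal,
    RCLike.re_eq_complex_re, Complex.ofReal_re, overlapVector, norm_smul, hφ, hφ, mul_one,
    ← fidelity]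
  ring

/-- The phase of `φ x'` cancels, so wherever the fidelity is nonzero an expectation value is a
quotient of functions that inherit the differentiability of `overlapVector`. -/
theorem fidelity_mul_inner_map (φ : X → H) (x x' : X) (M : H →L[ℂ] H) :
    inner ℂ (overlapVector φ x x') (M (overlapVector φ x x')) =
      (fidelity φ x x' : ℂ) * inner ℂ (φ x') (M (φ x')) := by
  rw [overlapVector, map_smul, inner_smul_left, inner_smul_right, ← mul_assoc,
    mul_comm ((starRingEnd ℂ) _), Complex.mul_conj, fidelity, Complex.normSq_eq_norm_sq]

include hφ in
theorem isLocalMax_fidelity [TopologicalSpace X] (x : X) :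
    IsLocalMax (fidelity φ x) x :=
  Eventually.of_forall fun x' => by
    rw [fidelity_self hφ]
    exact fidelity_le_one hφ x x'

variable [NormedAddCommGroup X] [NormedSpace ℝ X]

/-- The derivative of `x' ↦ Re ⟪a, z x'⟫`. -/
theorem hasFDerivAt_re_inner_const (a : H) {z : X → H} {Z : X →L[ℝ] H} {x : X}
    (hZ : HasFDerivAt z Z x) :
    HasFDerivAt (fun x' => (inner ℂ a (z x')).re)
      ((Complex.reCLM.comp ((innerSL ℂ a).restrictScalars ℝ)).comp Z) x :=
  (Complex.reCLM.comp ((innerSL ℂ a).restrictScalars ℝ)).hasFDerivAt.comp x hZ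

theorem differentiableAt_fidelity {x x' : X}
    (h : DifferentiableAt ℝ (overlapVector φ x) x') : DifferentiableAt ℝ (fidelity φ x) x' := by
  have := (hasFDerivAt_re_inner_const (φ x) h.hasFDerivAt).differentiableAt
  exact this.congr_of_eventuallyEq (Eventually.of_forall fun y => fidelity_eq_re φ x y)

variable {x : X} {Z : X →L[ℝ] H} (hZ : HasFDerivAt (overlapVector φ x) Z x)

-- This real part is the derivative of the fidelity, which is maximal at `x' = x`.
include hφ hZ in
theorem re_inner_fderiv_overlapVector (v : X) : (inner ℂ (φ x) (Z v)).re = 0 := by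
  have h1 := hasFDerivAt_re_inner_const (φ x) hZ
  have h2 : HasFDerivAt (fidelity φ x) _ x :=
    h1.congr_of_eventuallyEq (Eventually.of_forall fun y => fidelity_eq_re φ x y)
  have h3 := (isLocalMax_fidelity hφ x).hasFDerivAt_eq_zero h2
  exact congrArg (fun T : X →L[ℝ] ℝ => T v) h3

-- Along the line `x + t v`, the quotient `(1 - F) / t²` has two limits: half of minus the second
-- derivative by Taylor, and `‖Z v‖²` by Pythagoras.
include hφ hZ in
theorem fderiv_fderiv_fidelity_self
    (hd : ∀ᶠ x' in 𝓝 x, DifferentiableAt ℝ (fidelity φ x) x')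
    (hF : DifferentiableAt ℝ (fderiv ℝ (fidelity φ x)) x) (v : X) :
    fderiv ℝ (fderiv ℝ (fidelity φ x)) x v v = -2 * ‖Z v‖ ^ 2 := by
  have hl : HasDerivAt (fun t : ℝ => x + t • v) v 0 := by
    simpa using ((hasDerivAt_id (0 : ℝ)).smul_const v).const_add x
  have hl0 : x + (0 : ℝ) • v = x := by simp
  have hline : ∀ t : ℝ, HasDerivAt (fun t : ℝ => x + t • v) v t := fun t => by
    simpa using ((hasDerivAt_id t).smul_const v).const_add x
  have h1 : Tendsto (fun t : ℝ => (1 - fidelity φ x (x + t • v)) / t ^ 2) (𝓝[≠] 0)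
      (𝓝 (-(fderiv ℝ (fderiv ℝ (fidelity φ x)) x v v) / 2)) := by
    apply tendsto_div_sq_of_hasDerivAt
      (g' := fun t : ℝ => -(fderiv ℝ (fidelity φ x) (x + t • v) v))
    · have hc := hl.continuousAt.tendsto
      rw [hl0] at hc
      filter_upwards [hc.eventually hd] with t ht
      exact (ht.hasFDerivAt.comp_hasDerivAt t (hline t)).const_sub 1
    · have h := hF.hasFDerivAt.comp_hasDerivAt_of_eq (0 : ℝ) hl hl0.symm
      exact (h.clm_apply (hasDerivAt_const (0 : ℝ) v)).neg.congr_deriv (by simp)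
    · simp [fidelity_self hφ]
    · simp [(isLocalMax_fidelity hφ x).fderiv_eq_zero]
  have h2 : Tendsto (fun t : ℝ => (1 - fidelity φ x (x + t • v)) / t ^ 2) (𝓝[≠] 0)
      (𝓝 (‖Z v‖ ^ 2)) := by
    have h := (hZ.comp_hasDerivAt_of_eq (0 : ℝ) hl hl0.symm).tendsto_slope_zero
    refine (h.norm.pow 2).congr fun t => ?_
    simp only [Function.comp_apply, zero_add, hl0, overlapVector_self hφ]
    rw [norm_smul, mul_pow, norm_overlapVector_sub_sq hφ, norm_inv, inv_pow, Real.norm_eq_abs,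
      sq_abs, inv_mul_eq_div]
  have := tendsto_nhds_unique h1 h2
  linarith

include hφ hZ in
/-- The derivative of the expectation value of a positive operator. -/
theorem hasFDerivAt_re_inner_map {M : H →L[ℂ] H} (hM : M.IsPositive) :
    HasFDerivAt (fun x' => (inner ℂ (φ x') (M (φ x'))).re)
      ((2 : ℝ) • (Complex.reCLM.comp ((innerSL ℂ (φ x)).restrictScalars ℝ)).comp
        ((M.restrictScalars ℝ).comp Z)) x := by
  have hf := hasFDerivAt_re_inner_const (φ x) hZ
  have hf2 : HasFDerivAt (fidelity φ x) (0 : X →L[ℝ] ℝ) x := by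
    have h2 : HasFDerivAt (fidelity φ x) _ x :=
      hf.congr_of_eventuallyEq (Eventually.of_forall fun y => fidelity_eq_re φ x y)
    rwa [(isLocalMax_fidelity hφ x).hasFDerivAt_eq_zero h2] at h2
  have hMZ : HasFDerivAt (fun x' => M (overlapVector φ x x')) ((M.restrictScalars ℝ).comp Z) x :=
    (M.restrictScalars ℝ).hasFDerivAt.comp x hZ
  have hq := Complex.reCLM.hasFDerivAt.comp x (hZ.inner ℂ hMZ)
  have hne : fidelity φ x x ≠ 0 := by rw [fidelity_self hφ]; exact one_ne_zero
  -- The expectation is ⟨z, M z⟩ / F near `x`. Since F = 1 and dF = 0 at `x`, only the numerator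
  -- contributes.
  have hd := hq.mul ((hasDerivAt_inv hne).comp_hasFDerivAt x hf2)
  have hev : ∀ᶠ x' in 𝓝 x, fidelity φ x x' ≠ 0 :=
    hf2.continuousAt.eventually_ne hne
  have hd' := hd.congr_of_eventuallyEq (f₁ := fun x' => (inner ℂ (φ x') (M (φ x'))).re) (by
    filter_upwards [hev] with x' hx'
    simp only [Pi.mul_apply, Function.comp_apply, Complex.reCLM_apply, fidelity_mul_inner_map,
      Complex.re_ofReal_mul]
    rw [mul_comm, inv_mul_cancel_left₀ hx'])
  refine hd'.congr_fderiv ?_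
  ext v
  have hs : (inner ℂ (Z v) (M (φ x))).re = (inner ℂ (φ x) (M (Z v))).re := by
    have h : inner ℂ (M (Z v)) (φ x) = inner ℂ (Z v) (M (φ x)) := hM.isSymmetric (Z v) (φ x)
    rw [← h, ← inner_conj_symm, Complex.conj_re]
  simp [overlapVector_self hφ, fidelity_self hφ, fderivInnerCLM_apply, hs]
  ring

end PureState

/-! ### The pointwise quadratic inequality and integration by parts -/

section Score

/-- Sum over `i` the positivity of `T i` at the vector `(c i + t) a + 2 w`; the cross term `4 t
Re⟨a, w⟩` vanishes by `hw`. This is the bound of classical by quantum Fisher information without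
dividing by outcome probabilities, which may vanish. -/
theorem sum_sq_add_score_nonneg {H : Type*} [NormedAddCommGroup H] [InnerProductSpace ℂ H]
    {ι : Type*} (R : Finset ι) (T : ι → H →L[ℂ] H) (hT : ∀ i, (T i).IsPositive)
    (hsum : ∑ i ∈ R, T i = 1) {a w : H} (ha : ‖a‖ = 1) (hw : (inner ℂ a w).re = 0) (c : ι → ℝ)
    (t : ℝ) :
    0 ≤ ∑ i ∈ R, c i ^ 2 * (inner ℂ a (T i a)).re +
      2 * ∑ i ∈ R, c i * (t * (inner ℂ a (T i a)).re + 2 * (inner ℂ a (T i w)).re) +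
      (t ^ 2 + 4 * ‖w‖ ^ 2) := by
  have hsum' : ∀ b d : H, ∑ i ∈ R, (inner ℂ b (T i d)).re = (inner ℂ b d).re := by
    intro b d
    have h := congrArg (fun S : H →L[ℂ] H => (inner ℂ b (S d)).re) hsum
    simpa [_root_.sum_apply, inner_sum] using h
  have hterm : ∀ i, 0 ≤ (c i + t) ^ 2 * (inner ℂ a (T i a)).re +
      4 * (c i + t) * (inner ℂ a (T i w)).re + 4 * (inner ℂ w (T i w)).re := by
    intro i
    have h := (hT i).re_inner_nonneg_right (((c i + t : ℝ) : ℂ) • a + ((2 : ℝ) : ℂ) • w)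
    have hs : (inner ℂ w (T i a)).re = (inner ℂ a (T i w)).re := by
      have h : inner ℂ (T i w) a = inner ℂ w (T i a) := (hT i).isSymmetric w a
      rw [← h, ← inner_conj_symm, Complex.conj_re]
    have e : RCLike.re (inner ℂ (((c i + t : ℝ) : ℂ) • a + ((2 : ℝ) : ℂ) • w)
        (T i (((c i + t : ℝ) : ℂ) • a + ((2 : ℝ) : ℂ) • w))) =
        (c i + t) ^ 2 * (inner ℂ a (T i a)).re +
          4 * (c i + t) * (inner ℂ a (T i w)).re + 4 * (inner ℂ w (T i w)).re := by
      rw [map_add, map_smul, map_smul]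
      simp only [inner_add_left, inner_add_right, inner_smul_left, inner_smul_right,
        Complex.conj_ofReal, RCLike.re_eq_complex_re, Complex.add_re, Complex.re_ofReal_mul, hs]
      ring
    rwa [e] at h
  have h := Finset.sum_nonneg fun i (_ : i ∈ R) => hterm i
  have haa : (inner ℂ a a).re = 1 := by
    rw [inner_self_eq_norm_sq_to_K, ha]; simp
  have hww : (inner ℂ w w).re = ‖w‖ ^ 2 := by
    rw [inner_self_eq_norm_sq_to_K]; norm_cast
  have e : ∑ i ∈ R, ((c i + t) ^ 2 * (inner ℂ a (T i a)).re +
      4 * (c i + t) * (inner ℂ a (T i w)).re + 4 * (inner ℂ w (T i w)).re) =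
      ∑ i ∈ R, c i ^ 2 * (inner ℂ a (T i a)).re +
      2 * ∑ i ∈ R, c i * (t * (inner ℂ a (T i a)).re + 2 * (inner ℂ a (T i w)).re) +
      (t ^ 2 * ∑ i ∈ R, (inner ℂ a (T i a)).re + 4 * t * ∑ i ∈ R, (inner ℂ a (T i w)).re +
        4 * ∑ i ∈ R, (inner ℂ w (T i w)).re) := by
    simp only [Finset.mul_sum, ← Finset.sum_add_distrib]
    exact Finset.sum_congr rfl fun i _ => by ring
  rw [e, hsum', hsum', hsum', haa, hww, hw] at h
  linarith

variable {X : Type*} [NormedAddCommGroup X] [NormedSpace ℝ X] [FiniteDimensional ℝ X]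
  [MeasurableSpace X] [BorelSpace X] {μ : Measure X} [μ.IsAddHaarMeasure]

theorem integral_fderiv_eq_zero {G : X → ℝ} {G' : X → X →L[ℝ] ℝ} {v : X}
    (hG : ∀ x, HasFDerivAt G (G' x) x) (hGi : Integrable G μ)
    (hGi' : Integrable (fun x => G' x v) μ) : ∫ x, G' x v ∂μ = 0 := by
  have h := integral_bilinear_hasFDerivAt_right_eq_neg_left_of_integrable (μ := μ)
    (f := fun _ : X => (1 : ℝ)) (f' := fun _ => 0) (g := G) (g' := G') (v := v)
    (B := ContinuousLinearMap.mul ℝ ℝ) (by simp) (by simpa using hGi') (by simpa using hGi)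
    (fun x _ => hasFDerivAt_const _ _) (fun x _ => hG x)
  simpa using h

/-- Use the weights `ψ (r - l x)` in `hq` and integrate. The `v`-derivative of `∑ ψ (r - l x) K r x`
has integral zero, which trades `∑ ψ ∂K` for `l v ∑ ψ' K`. -/
theorem integral_truncated_score_nonneg (R : Finset ℝ) (K : ℝ → X → ℝ)
    (hK : ∀ r, Differentiable ℝ (K r)) (hK0 : ∀ r x, 0 ≤ K r x)
    (hKi : ∀ r, Integrable (K r) μ) {v : X} {Q : X → ℝ} (hQ : Integrable Q μ)
    (hq : ∀ (c : ℝ → ℝ) x,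
      0 ≤ ∑ r ∈ R, c r ^ 2 * K r x + 2 * ∑ r ∈ R, c r * fderiv ℝ (K r) x v + Q x)
    (l : X →L[ℝ] ℝ) {ψ ψ' : ℝ → ℝ} (hψ : ∀ e, HasDerivAt ψ (ψ' e) e) (hψ' : Continuous ψ')
    {C : ℝ} (hC : ∀ e, |ψ e| ≤ C) (hC' : ∀ e, |ψ' e| ≤ C) :
    0 ≤ ∫ x, (∑ r ∈ R, (ψ (r - l x) ^ 2 + 2 * l v * ψ' (r - l x)) * K r x) ∂μ + ∫ x, Q x ∂μ := by
  have hψc : Continuous ψ := continuous_iff_continuousAt.2 fun e => (hψ e).continuousAt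
  have hbdd : ∀ (f : ℝ → ℝ) (D : ℝ), Continuous f → (∀ e, |f e| ≤ D) → ∀ r,
      Integrable (fun x => f (r - l x) * K r x) μ := by
    intro f D hf hD r
    refine (hKi r).bdd_mul (c := D) ?_ (Filter.Eventually.of_forall fun x => hD _)
    exact (hf.comp (continuous_const.sub l.continuous)).aestronglyMeasurable
  have hi1 : ∀ r, Integrable (fun x => ψ (r - l x) * K r x) μ := hbdd ψ C hψc hC
  have hi2 : ∀ r, Integrable (fun x => ψ' (r - l x) * K r x) μ := hbdd ψ' C hψ' hC'
  have hi3 : ∀ r, Integrable (fun x => ψ (r - l x) ^ 2 * K r x) μ :=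
    hbdd (fun e => ψ e ^ 2) (C ^ 2) (hψc.pow 2) fun e => by
      rw [abs_pow]; exact pow_le_pow_left₀ (abs_nonneg _) (hC e) 2
  let G : X → ℝ := fun x => ∑ r ∈ R, ψ (r - l x) * K r x
  let G' : X → X →L[ℝ] ℝ := fun x =>
    ∑ r ∈ R, (ψ (r - l x) • fderiv ℝ (K r) x + K r x • (ψ' (r - l x) • (-l)))
  have hG : ∀ x, HasFDerivAt G (G' x) x := by
    intro x
    refine HasFDerivAt.fun_sum fun r _ => ?_
    exact ((hψ _).comp_hasFDerivAt x (l.hasFDerivAt.const_sub r)).mul (hK r x).hasFDerivAt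
  have hG'v : ∀ x, G' x v = ∑ r ∈ R, ψ (r - l x) * fderiv ℝ (K r) x v -
      l v * ∑ r ∈ R, ψ' (r - l x) * K r x := by
    intro x
    simp only [G', _root_.sum_apply, Finset.mul_sum, ← Finset.sum_sub_distrib]
    refine Finset.sum_congr rfl fun r _ => ?_
    simp
    ring
  have hGc : Continuous G := continuous_iff_continuousAt.2 fun x => (hG x).continuousAt
  have hGi : Integrable G μ := integrable_finsetSum _ fun r _ => hi1 r
  have hS2 : Integrable (fun x => ∑ r ∈ R, ψ' (r - l x) * K r x) μ :=
    integrable_finsetSum _ fun r _ => hi2 r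
  have hS3 : Integrable (fun x => ∑ r ∈ R, ψ (r - l x) ^ 2 * K r x) μ :=
    integrable_finsetSum _ fun r _ => hi3 r
  -- The derivatives of `K r` need not be continuous, but line derivatives of a continuous function
  -- are measurable.
  have hG'm : AEStronglyMeasurable (fun x => G' x v) μ := by
    have h := aestronglyMeasurable_lineDeriv (𝕜 := ℝ) (v := v) hGc μ
    refine h.congr (Filter.Eventually.of_forall fun x => ?_)
    exact ((hG x).hasLineDerivAt v).lineDeriv
  -- The inequality `hq` at the weights `ψ` and `-ψ` bounds this sum by `∑ ψ² K + Q`, so its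
  -- integrability is not an extra assumption.
  have hi4 : Integrable (fun x => ∑ r ∈ R, ψ (r - l x) * fderiv ℝ (K r) x v) μ := by
    refine (hS3.add hQ).mono' ?_ (Filter.Eventually.of_forall fun x => ?_)
    · refine (hG'm.add (hS2.aestronglyMeasurable.const_mul (l v))).congr
        (Filter.Eventually.of_forall fun x => ?_)
      simp [hG'v]
    · have h1 := hq (fun r => ψ (r - l x)) x
      have h2 := hq (fun r => -ψ (r - l x)) x
      have h0 := hq (fun _ => 0) x
      simp only [neg_sq, neg_mul, Finset.sum_neg_distrib, Pi.add_apply] at h2 ⊢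
      have h3 : 0 ≤ ∑ r ∈ R, ψ (r - l x) ^ 2 * K r x :=
        Finset.sum_nonneg fun r _ => mul_nonneg (sq_nonneg _) (hK0 r x)
      simp at h0
      rw [Real.norm_eq_abs, abs_le]
      constructor <;> linarith
  have hG'i : Integrable (fun x => G' x v) μ :=
    (hi4.sub (hS2.const_mul (l v))).congr (Filter.Eventually.of_forall fun x => (hG'v x).symm)
  have hzero := integral_fderiv_eq_zero hG hGi hG'i
  have hS5 : Integrable
      (fun x => ∑ r ∈ R, (ψ (r - l x) ^ 2 + 2 * l v * ψ' (r - l x)) * K r x) μ := by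
    refine integrable_finsetSum _ fun r _ => ((hi3 r).add ((hi2 r).const_mul (2 * l v))).congr
      (Filter.Eventually.of_forall fun x => ?_)
    simp
    ring
  have h : 0 ≤ ∫ x, ((∑ r ∈ R, (ψ (r - l x) ^ 2 + 2 * l v * ψ' (r - l x)) * K r x) + Q x +
      2 * G' x v) ∂μ := by
    refine integral_nonneg fun x => ?_
    have h := hq (fun r => ψ (r - l x)) x
    simp only [Pi.zero_apply, hG'v, add_mul, Finset.sum_add_distrib, mul_assoc]
    simp only [← Finset.mul_sum]
    linarith
  rwa [integral_add (hS5.fun_add hQ) (hG'i.const_mul 2), integral_add hS5 hQ, integral_const_mul,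
    hzero, mul_zero, add_zero] at h

end Score

/-! ### Joint densities of parameter and outcome, including zeros of the prior -/

section Joint

open Filter Topology ProbabilityTheory

variable {Y : Type*} [MeasurableSpace Y] {H : Type*} [NormedAddCommGroup H]
  [InnerProductSpace ℂ H]

theorem POVM.isProbabilityMeasure_outcome (M : POVM Y H) {a : H} (ha : ‖a‖ = 1) :
    IsProbabilityMeasure (M.outcome a) := by
  refine ⟨?_⟩
  rw [M.outcome_apply a MeasurableSet.univ, M.effect_univ, one_apply_eq_self,
    inner_self_eq_norm_sq_to_K, ha]
  simp

theorem POVM.real_outcome (M : POVM Y H) (a : H) {s : Set Y} (hs : MeasurableSet s) :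
    (M.outcome a).real s = (inner ℂ a (M.effect s a)).re := by
  rw [Measure.real, M.outcome_apply a hs, ENNReal.toReal_ofReal (M.re_nonneg hs a)]

theorem POVM.abs_re_inner_le_one (M : POVM Y H) {a : H} (ha : ‖a‖ = 1) {s : Set Y}
    (hs : MeasurableSet s) : |(inner ℂ a (M.effect s a)).re| ≤ 1 := by
  have := M.isProbabilityMeasure_outcome ha
  rw [← M.real_outcome _ hs, abs_of_nonneg measureReal_nonneg]
  exact measureReal_le_one

theorem POVM.sum_effect_preimage (M : POVM Y H) (a : SimpleFunc Y ℝ) :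
    ∑ r ∈ a.range, M.effect (a ⁻¹' {r}) = 1 := by
  classical
  have h : ∀ R : Finset ℝ, M.effect (a ⁻¹' (R : Set ℝ)) = ∑ r ∈ R, M.effect (a ⁻¹' {r}) := by
    intro R
    induction R using Finset.induction_on with
    | empty => simp [M.effect_empty]
    | insert r R hr ih =>
      rw [Finset.sum_insert hr, Finset.coe_insert, Set.insert_eq, Set.preimage_union,
        M.effect_union (a.measurableSet_preimage _) (a.measurableSet_preimage _), ih]
      exact Disjoint.preimage _ (by simpa using hr)
  rw [← h, ← M.effect_univ]
  congr 1
  ext y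
  simp

theorem SimpleFunc.integral_comp {ν : Measure Y} [IsFiniteMeasure ν] (a : SimpleFunc Y ℝ)
    (f : ℝ → ℝ) : ∫ y, f (a y) ∂ν = ∑ r ∈ a.range, f r * ν.real (a ⁻¹' {r}) := by
  classical
  have h : ∀ y, f (a y) = ∑ r ∈ a.range, (a ⁻¹' {r}).indicator (fun _ => f r) y := by
    intro y
    rw [Finset.sum_eq_single (a y)]
    · simp
    · intro r _ hr
      simp [hr.symm]
    · intro h
      simp at h
  simp only [h]
  rw [integral_finsetSum]
  · refine Finset.sum_congr rfl fun r _ => ?_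
    rw [integral_indicator_const _ (a.measurableSet_preimage _), smul_eq_mul, mul_comm]
  · exact fun r _ => (integrable_const _).indicator (a.measurableSet_preimage _)

variable {X : Type*} [NormedAddCommGroup X] [NormedSpace ℝ X]

/-- Here `p` is `o(‖x' - x‖)`, which absorbs any bounded factor. Thus the joint density is
differentiable at zeros of the prior, where the likelihood may be irregular. -/
theorem hasFDerivAt_mul_of_eq_zero {p f : X → ℝ} {x : X} (hp : HasFDerivAt p (0 : X →L[ℝ] ℝ) x)
    (h0 : p x = 0) {C : ℝ} (hf : ∀ x, |f x| ≤ C) :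
    HasFDerivAt (fun x => p x * f x) (0 : X →L[ℝ] ℝ) x := by
  rw [hasFDerivAt_iff_isLittleO] at hp ⊢
  simp only [h0, zero_mul, sub_zero, zero_apply] at hp ⊢
  have h1 : f =O[𝓝 x] fun _ => (1 : ℝ) :=
    Asymptotics.IsBigO.of_bound C (Eventually.of_forall fun y => by simpa using hf y)
  simpa using hp.norm_right.mul_isBigO h1

/-- The density of the information about the direction `v` carried by the pure-state family `φ`
with prior `p`. -/
def infoDensity (p : X → ℝ) (φ : X → H) (v x : X) : ℝ :=
  p x * ((fderiv ℝ p x v / p x) ^ 2 + 4 * ‖fderiv ℝ (overlapVector φ x) x v‖ ^ 2)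

variable {p : X → ℝ} (hp0 : ∀ x, 0 ≤ p x) (hpd : Differentiable ℝ p)
  {φ : X → H} (hφ : ∀ x, ‖φ x‖ = 1)
  (hz : ∀ x, 0 < p x → DifferentiableAt ℝ (overlapVector φ x) x) (M : POVM Y H)

include hp0 hpd in
theorem fderiv_eq_zero_of_nonneg {x : X} (h0 : p x = 0) : HasFDerivAt p (0 : X →L[ℝ] ℝ) x := by
  have hm : IsLocalMin p x := Eventually.of_forall fun y => by rw [h0]; exact hp0 y
  have h := (hpd x).hasFDerivAt
  rwa [hm.fderiv_eq_zero] at h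

include hp0 hpd hφ hz in
theorem differentiable_mul_re_inner {s : Set Y} (hs : MeasurableSet s) :
    Differentiable ℝ fun x => p x * (inner ℂ (φ x) (M.effect s (φ x))).re := by
  intro x
  rcases (hp0 x).eq_or_lt with h0 | h0
  · exact (hasFDerivAt_mul_of_eq_zero (fderiv_eq_zero_of_nonneg hp0 hpd h0.symm) h0.symm
      fun x => M.abs_re_inner_le_one (hφ x) hs).differentiableAt
  · exact (hpd x).mul
      (hasFDerivAt_re_inner_map hφ (hz x h0).hasFDerivAt (M.isPositive s hs)).differentiableAt

-- Where `p x > 0` this is `p x` times `sum_sq_add_score_nonneg`, with `t` the logarithmic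
-- derivative of the prior and `w` the derivative of `overlapVector`. Where `p x = 0` every term
-- vanishes.
include hp0 hpd hφ hz in
theorem quadratic_score_nonneg (a : SimpleFunc Y ℝ) (v : X) (c : ℝ → ℝ) (x : X) :
    0 ≤ ∑ r ∈ a.range, c r ^ 2 * (p x * (inner ℂ (φ x) (M.effect (a ⁻¹' {r}) (φ x))).re) +
      2 * ∑ r ∈ a.range, c r *
        fderiv ℝ (fun x => p x * (inner ℂ (φ x) (M.effect (a ⁻¹' {r}) (φ x))).re) x v +
      infoDensity p φ v x := by
  have hs : ∀ r, MeasurableSet (a ⁻¹' {r}) := fun r => a.measurableSet_preimage _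
  rcases (hp0 x).eq_or_lt with h0 | h0
  · have h : ∀ r, fderiv ℝ
        (fun x => p x * (inner ℂ (φ x) (M.effect (a ⁻¹' {r}) (φ x))).re) x = 0 := fun r =>
      (hasFDerivAt_mul_of_eq_zero (fderiv_eq_zero_of_nonneg hp0 hpd h0.symm) h0.symm
        fun x => M.abs_re_inner_le_one (hφ x) (hs r)).fderiv
    simp [h, ← h0, infoDensity]
  · have h : ∀ r, fderiv ℝ
        (fun x => p x * (inner ℂ (φ x) (M.effect (a ⁻¹' {r}) (φ x))).re) x v =
          p x * ((fderiv ℝ p x v / p x) * (inner ℂ (φ x) (M.effect (a ⁻¹' {r}) (φ x))).re +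
            2 * (inner ℂ (φ x)
              (M.effect (a ⁻¹' {r}) (fderiv ℝ (overlapVector φ x) x v))).re) := by
      intro r
      have h := (hpd x).hasFDerivAt.mul
        (hasFDerivAt_re_inner_map hφ (hz x h0).hasFDerivAt (M.isPositive _ (hs r)))
      have h' := congrArg (fun T : X →L[ℝ] ℝ => T v) h.fderiv
      refine h'.trans ?_
      simp
      field_simp
      ring
    have key := sum_sq_add_score_nonneg a.range (fun r => M.effect (a ⁻¹' {r}))
      (fun r => M.isPositive _ (hs r)) (M.sum_effect_preimage a) (hφ x)
      (re_inner_fderiv_overlapVector hφ (hz x h0).hasFDerivAt v) c (fderiv ℝ p x v / p x)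
    refine (mul_nonneg h0.le key).trans_eq ?_
    simp only [h, infoDensity, mul_add, Finset.mul_sum]
    congr 2
    · exact Finset.sum_congr rfl fun r _ => by ring
    · exact Finset.sum_congr rfl fun r _ => by ring

variable [MeasurableSpace X] [BorelSpace X]

-- On `{p > 0}` the probability of each event is continuous in `x`. Elsewhere the likelihood need
-- not be measurable in `x`, so a constant law replaces it; the prior gives that set no mass.
include hφ hz hpd in
theorem exists_kernel_outcome :
    ∃ κ : Kernel X Y, IsMarkovKernel κ ∧ ∀ x, 0 < p x → κ x = M.outcome (φ x) := by
  classical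
  let O : Set X := {x | 0 < p x}
  have hO : MeasurableSet O := measurableSet_lt measurable_const hpd.continuous.measurable
  refine ⟨⟨O.piecewise (fun x => M.outcome (φ x)) (fun _ => M.outcome (φ 0)), ?_⟩, ⟨fun x => ?_⟩,
    fun x hx => ?_⟩
  · refine Measure.measurable_of_measurable_coe _ fun s hs => ?_
    have h : Measurable (O.piecewise
        (fun x => ENNReal.ofReal (inner ℂ (φ x) (M.effect s (φ x))).re)
        (fun _ => M.outcome (φ 0) s)) := by
      refine ContinuousOn.measurable_piecewise ?_ continuousOn_const hO
      refine ENNReal.continuous_ofReal.comp_continuousOn fun x hx => ?_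
      exact (hasFDerivAt_re_inner_map hφ (hz x hx).hasFDerivAt
        (M.isPositive s hs)).continuousAt.continuousWithinAt
    convert h using 1
    ext x
    by_cases hx : x ∈ O
    · simp [hx, M.outcome_apply _ hs]
    · simp [hx]
  · by_cases hx : x ∈ O
    · simpa [hx] using M.isProbabilityMeasure_outcome (hφ x)
    · simpa [hx] using M.isProbabilityMeasure_outcome (hφ 0)
  · exact O.piecewise_eq_of_mem (fun x => M.outcome (φ x)) (fun _ => M.outcome (φ 0)) hx

end Joint

/-! ### Integration against the joint distribution -/

section Bayes

open Filter Topology ProbabilityTheory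

variable {X : Type*} [MeasurableSpace X] {Y : Type*} [MeasurableSpace Y]

/-- The joint distribution of the parameter, with prior density `p`, and the observation, with
likelihood `κ`. -/
def jointMeasure (μ : Measure X) (p : X → ℝ) (κ : Kernel X Y) : Measure (X × Y) :=
  (μ.withDensity fun x => ENNReal.ofReal (p x)) ⊗ₘ κ

variable {μ : Measure X} {p : X → ℝ} (hp0 : ∀ x, 0 ≤ p x) {κ : Kernel X Y}
  (hpm : Measurable p) {L : X → Measure Y} (hκ : ∀ x, 0 < p x → κ x = L x)

theorem integrable_jointMeasure_of_bound [IsFiniteMeasure (jointMeasure μ p κ)]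
    {f : X × Y → ℝ} (hf : Measurable f) (C : ℝ)
    (hC : ∀ z, |f z| ≤ C) : Integrable f (jointMeasure μ p κ) :=
  (integrable_const C).mono' hf.aestronglyMeasurable (Eventually.of_forall hC)

variable [IsMarkovKernel κ]

include hp0 in
theorem isProbabilityMeasure_jointMeasure (hpi : Integrable p μ) (hp1 : ∫ x, p x ∂μ = 1) :
    IsProbabilityMeasure (jointMeasure μ p κ) := by
  have : IsProbabilityMeasure (μ.withDensity fun x => ENNReal.ofReal (p x)) := by
    refine ⟨?_⟩
    rw [withDensity_apply _ MeasurableSet.univ, Measure.restrict_univ,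
      ← ofReal_integral_eq_lintegral_ofReal hpi (Eventually.of_forall hp0), hp1,
      ENNReal.ofReal_one]
  rw [jointMeasure]
  infer_instance

variable [SFinite μ]

include hp0 hpm hκ

theorem integral_jointMeasure {f : X × Y → ℝ} (hf : Integrable f (jointMeasure μ p κ)) :
    ∫ z, f z ∂(jointMeasure μ p κ) = ∫ x, p x * ∫ y, f (x, y) ∂(L x) ∂μ := by
  rw [jointMeasure, Measure.integral_compProd hf,
    integral_withDensity_eq_integral_toReal_smul hpm.ennreal_ofReal
      (Eventually.of_forall fun _ => ENNReal.ofReal_lt_top)]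
  refine integral_congr_ae (Eventually.of_forall fun x => ?_)
  simp only [ENNReal.toReal_ofReal (hp0 x), smul_eq_mul]
  rcases (hp0 x).eq_or_lt with h | h
  · simp [← h]
  · rw [hκ x h]

theorem lintegral_jointMeasure {f : X × Y → ENNReal} (hf : Measurable f) :
    ∫⁻ z, f z ∂(jointMeasure μ p κ) =
      ∫⁻ x, ENNReal.ofReal (p x) * ∫⁻ y, f (x, y) ∂(L x) ∂μ := by
  rw [jointMeasure, Measure.lintegral_compProd hf,
    lintegral_withDensity_eq_lintegral_mul _ hpm.ennreal_ofReal hf.lintegral_kernel_prod_right']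
  refine lintegral_congr fun x => ?_
  simp only [Pi.mul_apply]
  rcases (hp0 x).eq_or_lt with h | h
  · simp [← h]
  · rw [hκ x h]

end Bayes

/-! ### From simple estimators and bounded cutoffs to the scalar bound -/

section Limit

open Filter Topology ProbabilityTheory

variable {X : Type*} [NormedAddCommGroup X] [NormedSpace ℝ X] [FiniteDimensional ℝ X]
  [MeasurableSpace X] [BorelSpace X] {μ : Measure X} [μ.IsAddHaarMeasure]
  {Y : Type*} [MeasurableSpace Y] {H : Type*} [NormedAddCommGroup H] [InnerProductSpace ℂ H]
  {p : X → ℝ} (hp0 : ∀ x, 0 ≤ p x) (hpd : Differentiable ℝ p) (hpi : Integrable p μ)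
  {φ : X → H} (hφ : ∀ x, ‖φ x‖ = 1)
  (hz : ∀ x, 0 < p x → DifferentiableAt ℝ (overlapVector φ x) x) (M : POVM Y H)
  {κ : Kernel X Y} [IsMarkovKernel κ] (hκ : ∀ x, 0 < p x → κ x = M.outcome (φ x))
  [IsProbabilityMeasure (jointMeasure μ p κ)]
  {v : X} (hQ : Integrable (infoDensity p φ v) μ) (l : X →L[ℝ] ℝ)

include hp0 hpd hpi hφ hz hκ hQ in
theorem score_nonneg_simpleFunc {ψ ψ' : ℝ → ℝ} (hψ : ∀ e, HasDerivAt ψ (ψ' e) e)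
    (hψ' : Continuous ψ') {C : ℝ} (hC : ∀ e, |ψ e| ≤ C) (hC' : ∀ e, |ψ' e| ≤ C)
    (a : SimpleFunc Y ℝ) :
    0 ≤ ∫ z, (ψ (a z.2 - l z.1) ^ 2 + 2 * l v * ψ' (a z.2 - l z.1)) ∂(jointMeasure μ p κ) +
      ∫ x, infoDensity p φ v x ∂μ := by
  have hs : ∀ r, MeasurableSet (a ⁻¹' {r}) := fun r => a.measurableSet_preimage _
  have hψc : Continuous ψ := continuous_iff_continuousAt.2 fun e => (hψ e).continuousAt
  have hm : Measurable fun z : X × Y => a z.2 - l z.1 :=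
    (a.measurable.comp measurable_snd).sub (l.measurable.comp measurable_fst)
  have hdiff := fun r => differentiable_mul_re_inner hp0 hpd hφ hz M (hs r)
  have h := integral_truncated_score_nonneg (μ := μ) a.range
    (fun r x => p x * (inner ℂ (φ x) (M.effect (a ⁻¹' {r}) (φ x))).re) hdiff
    (fun r x => mul_nonneg (hp0 x) (M.re_nonneg (hs r) _))
    (fun r => hpi.mono' (hdiff r).continuous.aestronglyMeasurable (Eventually.of_forall fun x => by
      rw [norm_mul, Real.norm_of_nonneg (hp0 x)]
      exact mul_le_of_le_one_right (hp0 x) (M.abs_re_inner_le_one (hφ x) (hs r))))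
    hQ (quadratic_score_nonneg hp0 hpd hφ hz M a v) l hψ hψ' hC hC'
  have hi : Integrable (fun z : X × Y => ψ (a z.2 - l z.1) ^ 2 + 2 * l v * ψ' (a z.2 - l z.1))
      (jointMeasure μ p κ) := by
    refine Integrable.add ?_ (Integrable.const_mul ?_ _)
    · refine integrable_jointMeasure_of_bound ((hψc.measurable.comp hm).pow_const 2) (C ^ 2)
        fun z => ?_
      rw [abs_pow]
      exact pow_le_pow_left₀ (abs_nonneg _) (hC _) 2
    · exact integrable_jointMeasure_of_bound (hψ'.measurable.comp hm) C fun z => hC' _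
  refine h.trans_eq ?_
  rw [integral_jointMeasure hp0 hpd.continuous.measurable hκ hi]
  congr 1
  refine integral_congr_ae (Eventually.of_forall fun x => ?_)
  have := M.isProbabilityMeasure_outcome (hφ x)
  have h2 := SimpleFunc.integral_comp (ν := M.outcome (φ x)) a
    (fun r => ψ (r - l x) ^ 2 + 2 * l v * ψ' (r - l x))
  simp only [h2, Finset.mul_sum, M.real_outcome _ (hs _)]
  exact Finset.sum_congr rfl fun r _ => by ring

-- Approximate `b` pointwise by simple functions. Since `ψ` and `ψ'` are bounded and continuous,
-- dominated convergence applies with a constant bound.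
include hp0 hpd hpi hφ hz hκ hQ in
theorem score_nonneg_truncated {ψ ψ' : ℝ → ℝ} (hψ : ∀ e, HasDerivAt ψ (ψ' e) e)
    (hψ' : Continuous ψ') {C : ℝ} (hC : ∀ e, |ψ e| ≤ C) (hC' : ∀ e, |ψ' e| ≤ C)
    {b : Y → ℝ} (hb : Measurable b) :
    0 ≤ ∫ z, (ψ (b z.2 - l z.1) ^ 2 + 2 * l v * ψ' (b z.2 - l z.1)) ∂(jointMeasure μ p κ) +
      ∫ x, infoDensity p φ v x ∂μ := by
  have hψc : Continuous ψ := continuous_iff_continuousAt.2 fun e => (hψ e).continuousAt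
  have hψm := hψc.measurable
  have hψm' := hψ'.measurable
  let a : ℕ → SimpleFunc Y ℝ := hb.stronglyMeasurable.approx
  have ha : ∀ y, Tendsto (fun N => a N y) atTop (𝓝 (b y)) :=
    hb.stronglyMeasurable.tendsto_approx
  have hlim : Tendsto (fun N => ∫ z, (ψ (a N z.2 - l z.1) ^ 2 + 2 * l v * ψ' (a N z.2 - l z.1))
      ∂(jointMeasure μ p κ)) atTop
      (𝓝 (∫ z, (ψ (b z.2 - l z.1) ^ 2 + 2 * l v * ψ' (b z.2 - l z.1)) ∂(jointMeasure μ p κ))) := by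
    refine tendsto_integral_of_dominated_convergence (fun _ => C ^ 2 + |2 * l v| * C) (fun N => ?_)
      (integrable_const _) (fun N => Eventually.of_forall fun z => ?_)
      (Eventually.of_forall fun z => ?_)
    · have hm : Measurable fun z : X × Y => a N z.2 - l z.1 :=
        ((a N).measurable.comp measurable_snd).sub (l.measurable.comp measurable_fst)
      exact (((hψm.comp hm).pow_const 2).add
        ((hψm'.comp hm).const_mul (2 * l v))).aestronglyMeasurable
    · refine (norm_add_le _ _).trans (add_le_add ?_ ?_)
      · rw [norm_pow]
        exact pow_le_pow_left₀ (norm_nonneg _) (hC _) 2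
      · rw [norm_mul]
        exact mul_le_mul_of_nonneg_left (hC' _) (norm_nonneg _)
    · have hc : Continuous fun e => ψ (e - l z.1) ^ 2 + 2 * l v * ψ' (e - l z.1) := by fun_prop
      exact (hc.tendsto _).comp (ha z.2)
  exact ge_of_tendsto' (hlim.add_const _) fun N =>
    score_nonneg_simpleFunc hp0 hpd hpi hφ hz M hκ hQ l hψ hψ' hC hC' (a N)

include hp0 hpd hpi hφ hz hκ hQ in
/-- The scalar form of the Bayesian quantum Cramér–Rao inequality. -/
theorem score_nonneg {b : Y → ℝ} (hb : Measurable b)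
    (hi : Integrable (fun z : X × Y => (b z.2 - l z.1) ^ 2) (jointMeasure μ p κ)) :
    0 ≤ ∫ z, (b z.2 - l z.1) ^ 2 ∂(jointMeasure μ p κ) + 2 * l v +
      ∫ x, infoDensity p φ v x ∂μ := by
  have hm : Measurable fun z : X × Y => b z.2 - l z.1 :=
    (hb.comp measurable_snd).sub (l.measurable.comp measurable_fst)
  have hcos : ∀ N : ℕ, Measurable fun z : X × Y => Real.cos ((b z.2 - l z.1) / (N + 1)) :=
    fun N => Real.measurable_cos.comp (hm.div_const _)
  have hcosi : ∀ N : ℕ, Integrable (fun z : X × Y => Real.cos ((b z.2 - l z.1) / (N + 1)))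
      (jointMeasure μ p κ) := fun N =>
    integrable_jointMeasure_of_bound (hcos N) 1 fun z => Real.abs_cos_le_one _
  have hlim : Tendsto (fun N : ℕ => ∫ z, Real.cos ((b z.2 - l z.1) / (N + 1))
      ∂(jointMeasure μ p κ)) atTop (𝓝 1) := by
    have h1 : ∫ z : X × Y, (1 : ℝ) ∂(jointMeasure μ p κ) = 1 := by simp
    rw [← congrArg 𝓝 h1]
    refine tendsto_integral_of_dominated_convergence (fun _ => 1)
      (fun N => (hcos N).aestronglyMeasurable)
      (integrable_const _) (fun N => Eventually.of_forall fun z => Real.abs_cos_le_one _)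
      (Eventually.of_forall fun z => ?_)
    have h : Tendsto (fun N : ℕ => (b z.2 - l z.1) / ((N : ℝ) + 1)) atTop (𝓝 0) :=
      tendsto_const_nhds.div_atTop
        (tendsto_atTop_add_const_right _ 1 tendsto_natCast_atTop_atTop)
    simpa [Function.comp_def] using (Real.continuous_cos.tendsto 0).comp h
  have hstep : ∀ N : ℕ, 0 ≤ ∫ z, (b z.2 - l z.1) ^ 2 ∂(jointMeasure μ p κ) +
      2 * l v * ∫ z, Real.cos ((b z.2 - l z.1) / (N + 1)) ∂(jointMeasure μ p κ) +
      ∫ x, infoDensity p φ v x ∂μ := by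
    intro N
    have hN : (0 : ℝ) < N + 1 := by positivity
    -- The cutoff `(N + 1) sin (e / (N + 1))` is bounded, at most `|e|` in modulus, and has
    -- derivative `cos (e / (N + 1))`, which tends boundedly to 1.
    have h := score_nonneg_truncated hp0 hpd hpi hφ hz M hκ hQ l
      (ψ := fun e => (N + 1) * Real.sin (e / (N + 1))) (ψ' := fun e => Real.cos (e / (N + 1)))
      (C := N + 1)
      (fun e => by
        have h := (((hasDerivAt_id e).div_const ((N : ℝ) + 1)).sin).const_mul ((N : ℝ) + 1)
        refine h.congr_deriv ?_
        simp only [id]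
        field_simp)
      (by fun_prop)
      (fun e => by
        rw [abs_mul, abs_of_pos hN]
        exact mul_le_of_le_one_right hN.le (Real.abs_sin_le_one _))
      (fun e => (Real.abs_cos_le_one _).trans (by simp)) hb
    have hle : ∀ z : X × Y, ((N + 1) * Real.sin ((b z.2 - l z.1) / (N + 1))) ^ 2 ≤
        (b z.2 - l z.1) ^ 2 := by
      intro z
      rw [sq_le_sq, abs_mul, abs_of_pos hN]
      calc _ ≤ (N + 1) * |(b z.2 - l z.1) / (N + 1)| := 
          mul_le_mul_of_nonneg_left Real.abs_sin_le_abs hN.le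
        _ = _ := by rw [abs_div, abs_of_pos hN]; field_simp
    have hsini : Integrable
        (fun z : X × Y => ((N + 1) * Real.sin ((b z.2 - l z.1) / (N + 1))) ^ 2)
        (jointMeasure μ p κ) :=
      hi.mono' (((Real.measurable_sin.comp (hm.div_const _)).const_mul _).pow_const
        2).aestronglyMeasurable (Eventually.of_forall fun z => by
          rw [Real.norm_of_nonneg (sq_nonneg _)]; exact hle z)
    rw [integral_add hsini ((hcosi N).const_mul _), integral_const_mul] at h
    have := integral_mono hsini hi hle
    linarith
  have hfin := ((hlim.const_mul (2 * l v)).const_add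
    (∫ z, (b z.2 - l z.1) ^ 2 ∂(jointMeasure μ p κ))).add_const
    (∫ x, infoDensity p φ v x ∂μ)
  rw [mul_one] at hfin
  exact ge_of_tendsto' hfin hstep

end Limit

/-! ### Schur complement -/

section Matrices

open Matrix

/-- If the block matrix with diagonal blocks `S`, `J` and off-diagonal blocks `1` is positive
semidefinite, then `J` is positive definite and `J⁻¹ ≤ S`. -/
theorem posDef_and_posSemidef_sub_inv {ι : Type*} [Fintype ι] [DecidableEq ι]
    {S J : Matrix ι ι ℝ} (hS : S.IsHermitian) (hJ : J.IsHermitian)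
    (h : ∀ u v : ι → ℝ, 0 ≤ u ⬝ᵥ (S *ᵥ u) + 2 * (u ⬝ᵥ v) + v ⬝ᵥ (J *ᵥ v)) :
    J.PosDef ∧ (S - J⁻¹).PosSemidef := by
  have hpos : J.PosDef := by
    refine PosDef.of_dotProduct_mulVec_pos hJ fun v hv => ?_
    rw [star_trivial]
    by_contra! hq
    have hd : 0 < v ⬝ᵥ v := by simpa using dotProduct_star_self_pos_iff.2 hv
    have ha : 0 ≤ v ⬝ᵥ (S *ᵥ v) := by simpa using h v 0
    set d := v ⬝ᵥ v
    set a := v ⬝ᵥ (S *ᵥ v)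
    -- Test with `u = -s v`, `s = d / (1 + a)`: since `s a ≤ d`, the form is at most `-s d + v ⬝ᵥ J
    -- v < 0`. The 1 covers `a = 0`.
    have hs : 0 < d / (1 + a) := by positivity
    have hsa : d / (1 + a) * a ≤ d := by
      rw [div_mul_eq_mul_div, div_le_iff₀ (by positivity)]
      nlinarith
    have h1 := h (-(d / (1 + a)) • v) v
    simp only [mulVec_smul, smul_dotProduct, dotProduct_smul, smul_eq_mul] at h1
    change 0 ≤ -(d / (1 + a)) * (-(d / (1 + a)) * a) + 2 * (-(d / (1 + a)) * d) + _ at h1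
    nlinarith [mul_pos hs hd, mul_le_mul_of_nonneg_left hsa hs.le]
  refine ⟨hpos, PosSemidef.of_dotProduct_mulVec_nonneg (hS.sub hJ.inv) fun u => ?_⟩
  -- This `v` minimises the form for fixed `u`.
  have h1 := h u (-(J⁻¹ *ᵥ u))
  rw [mulVec_neg, mulVec_mulVec, mul_nonsing_inv _ ((isUnit_iff_isUnit_det J).1 hpos.isUnit),
    one_mulVec, neg_dotProduct_neg, dotProduct_neg, dotProduct_comm (J⁻¹ *ᵥ u)] at h1
  rw [star_trivial, sub_mulVec, dotProduct_sub]
  linarith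

end Matrices

/-! ### The modified purification and its information matrices in coordinates -/

section Purification

variable {A B : Type*} [NormedAddCommGroup A] [InnerProductSpace ℂ A] [CompleteSpace A]
  [NormedAddCommGroup B] [InnerProductSpace ℂ B] [CompleteSpace B]
  {Y : Type*} [MeasurableSpace Y] {n : ℕ}

/-- A unitary on the second factor does not change the expectation values of operators on the
first factor. -/
theorem inner_tensorOp_unitary (S : A →L[ℂ] A) (W : unitary (B →L[ℂ] B)) (z : HilbertTensor A B) :
    inner ℂ (tensorOp 1 (star (W : B →L[ℂ] B)) z)
      (tensorOp S 1 (tensorOp 1 (star (W : B →L[ℂ] B)) z)) = inner ℂ z (tensorOp S 1 z) := by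
  have h : tensorOp 1 (W : B →L[ℂ] B) * (tensorOp S 1 * tensorOp 1 (star (W : B →L[ℂ] B))) =
      tensorOp S 1 := by
    rw [← tensorOp_mul, ← tensorOp_mul, one_mul, one_mul, mul_one, Unitary.mul_star_self_of_mem W.2]
  rw [inner_tensorOp, star_one, star_star]
  exact congrArg (fun T : HilbertTensor A B →L[ℂ] HilbertTensor A B => inner ℂ z (T z)) h

variable (Ψ : HilbertTensor A B)
  (U : (Fin n → ℝ) → unitary (HilbertTensor A B →L[ℂ] HilbertTensor A B))
  (V : (Fin n → ℝ) → unitary (B →L[ℂ] B))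

theorem norm_purifiedVector {Ψ : HilbertTensor A B} (hΨ : ‖Ψ‖ = 1) (x : Fin n → ℝ) :
    ‖purifiedVector Ψ U V x‖ = 1 := by
  have h := inner_tensorOp_unitary (1 : A →L[ℂ] A) (V x)
    ((U x : HilbertTensor A B →L[ℂ] HilbertTensor A B) Ψ)
  rw [tensorOp_one, one_apply_eq_self, one_apply_eq_self] at h
  have h' := congrArg RCLike.re h
  rw [inner_self_eq_norm_sq, inner_self_eq_norm_sq,
    ContinuousLinearMap.norm_map_of_mem_unitary (U x).2, hΨ, one_pow] at h'
  exact (pow_eq_one_iff_of_nonneg (norm_nonneg _) two_ne_zero).1 h'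

theorem likelihood_eq_outcome (E : POVM Y A) (x : Fin n → ℝ) :
    likelihood E Ψ U x = (E.tensorOne B).outcome (purifiedVector Ψ U V x) := by
  ext s hs
  rw [likelihood, POVM.outcome_apply _ _ hs, POVM.outcome_apply _ _ hs]
  congr 2
  exact (inner_tensorOp_unitary (E.effect s) (V x) _).symm

variable {Ψ U V} {x : Fin n → ℝ}

-- `overlapVector` is the operator `ρ_x'` applied to the fixed vector `φ_x`, and evaluation at a
-- vector is continuous and linear.
omit [CompleteSpace A] in
theorem differentiableAt_overlapVector {x' : Fin n → ℝ}
    (h : DifferentiableAt ℝ (purifiedState Ψ U V) x') :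
    DifferentiableAt ℝ (overlapVector (purifiedVector Ψ U V) x) x' :=
  (((ContinuousLinearMap.apply ℂ (HilbertTensor A B)
    (purifiedVector Ψ U V x)).restrictScalars ℝ).differentiableAt).comp x' h

omit [CompleteSpace A] in
theorem fidelityHessian_eq
    (hd : ∀ᶠ x' in nhds x, DifferentiableAt ℝ (fidelity (purifiedVector Ψ U V) x) x')
    (hF : DifferentiableAt ℝ (fderiv ℝ (fidelity (purifiedVector Ψ U V) x)) x) (j k : Fin n) :
    fidelityHessian Ψ U V x j k =
      fderiv ℝ (fderiv ℝ (fidelity (purifiedVector Ψ U V) x)) x (Pi.single j 1)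
        (Pi.single k 1) := by
  have h : partialDeriv k (purifiedFidelity Ψ U V x) =ᶠ[nhds x]
      fun x' => fderiv ℝ (fidelity (purifiedVector Ψ U V) x) x' (Pi.single k 1) := by
    filter_upwards [hd] with x' hx'
    exact hx'.lineDeriv_eq_fderiv
  rw [fidelityHessian, partialDeriv, h.lineDeriv_eq]
  have h2 := hF.hasFDerivAt.clm_apply (hasFDerivAt_const (Pi.single k (1 : ℝ)) x)
  rw [h2.differentiableAt.lineDeriv_eq_fderiv, h2.fderiv]
  simp

omit [CompleteSpace A] in
theorem fidelityHessian_comm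
    (hd : ∀ᶠ x' in nhds x, DifferentiableAt ℝ (fidelity (purifiedVector Ψ U V) x) x')
    (hF : DifferentiableAt ℝ (fderiv ℝ (fidelity (purifiedVector Ψ U V) x)) x) (j k : Fin n) :
    fidelityHessian Ψ U V x j k = fidelityHessian Ψ U V x k j := by
  rw [fidelityHessian_eq hd hF, fidelityHessian_eq hd hF]
  exact second_derivative_symmetric_of_eventually (hd.mono fun _ h => h.hasFDerivAt)
    hF.hasFDerivAt _ _

theorem eq_sum_single (v : Fin n → ℝ) : v = ∑ j, v j • (Pi.single j 1 : Fin n → ℝ) := by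
  ext i
  simp [Finset.sum_apply, Pi.single_apply]

theorem priorInfoDensity_eq {p : (Fin n → ℝ) → ℝ} (hpd : Differentiable ℝ p) (hx : 0 < p x)
    (j k : Fin n) :
    priorInfoDensity p j k x =
      p x * (fderiv ℝ p x (Pi.single j 1) / p x) * (fderiv ℝ p x (Pi.single k 1) / p x) := by
  have h : ∀ j, partialDeriv j (fun z => Real.log (p z)) x =
      fderiv ℝ p x (Pi.single j 1) / p x := by
    intro j
    have h := (hpd x).hasFDerivAt.log hx.ne'
    rw [partialDeriv, h.differentiableAt.lineDeriv_eq_fderiv, h.fderiv]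
    simp [div_eq_inv_mul]
  rw [priorInfoDensity, h, h]

-- Both squares are quadratic forms in `v`, expanded in the standard basis. At zeros of the prior
-- both sides vanish.
omit [CompleteSpace A] in
theorem infoDensity_eq_sum {p : (Fin n → ℝ) → ℝ} (hp0 : ∀ x, 0 ≤ p x) (hpd : Differentiable ℝ p)
    (hφ : ∀ x, ‖purifiedVector Ψ U V x‖ = 1)
    (hz : 0 < p x → DifferentiableAt ℝ (overlapVector (purifiedVector Ψ U V) x) x)
    (hd : 0 < p x →
      ∀ᶠ x' in nhds x, DifferentiableAt ℝ (fidelity (purifiedVector Ψ U V) x) x')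
    (hF : 0 < p x → DifferentiableAt ℝ (fderiv ℝ (fidelity (purifiedVector Ψ U V) x)) x)
    (v : Fin n → ℝ) :
    infoDensity p (purifiedVector Ψ U V) v x = ∑ j, ∑ k, v j * v k *
      (-2 * (p x * fidelityHessian Ψ U V x j k) + priorInfoDensity p j k x) := by
  rcases (hp0 x).eq_or_lt with h0 | h0
  · simp [infoDensity, priorInfoDensity, ← h0]
  · have h1 : 4 * ‖fderiv ℝ (overlapVector (purifiedVector Ψ U V) x) x v‖ ^ 2 =
        ∑ j, ∑ k, v j * v k * (-2 * fidelityHessian Ψ U V x j k) := by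
      have h := fderiv_fderiv_fidelity_self hφ (hz h0).hasFDerivAt (hd h0) (hF h0) v
      have e : fderiv ℝ (fderiv ℝ (fidelity (purifiedVector Ψ U V) x)) x v v =
          ∑ j, ∑ k, v j * v k * fidelityHessian Ψ U V x j k := by
        simp only [fidelityHessian_eq (hd h0) (hF h0)]
        conv_lhs => rw [eq_sum_single v]
        simp only [map_sum, map_smul, _root_.sum_apply, _root_.smul_apply, smul_eq_mul,
          Finset.mul_sum]
        rw [Finset.sum_comm]
        exact Finset.sum_congr rfl fun _ _ => Finset.sum_congr rfl fun _ _ => by ring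
      calc _ = -2 * (-2 * ‖fderiv ℝ (overlapVector (purifiedVector Ψ U V) x) x v‖ ^ 2) := by ring
        _ = _ := by
          rw [← h, e]
          simp only [Finset.mul_sum]
          exact Finset.sum_congr rfl fun _ _ => Finset.sum_congr rfl fun _ _ => by ring
    have h2 : (fderiv ℝ p x v / p x) ^ 2 = ∑ j, ∑ k, v j * v k *
        ((fderiv ℝ p x (Pi.single j 1) / p x) * (fderiv ℝ p x (Pi.single k 1) / p x)) := by
      conv_lhs => rw [eq_sum_single v]
      simp only [map_sum, map_smul, smul_eq_mul, Finset.sum_div, sq, Finset.sum_mul_sum]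
      exact Finset.sum_congr rfl fun _ _ => Finset.sum_congr rfl fun _ _ => by ring
    rw [infoDensity, h1, h2]
    simp only [priorInfoDensity_eq hpd h0, ← Finset.sum_add_distrib, Finset.mul_sum]
    exact Finset.sum_congr rfl fun _ _ => Finset.sum_congr rfl fun _ _ => by ring

end Purification

end QuantumEstimation

end

/-! ### The matrix inequality -/

open MeasureTheory QuantumEstimation

theorem mainTheorem4 {A B : Type*} [NormedAddCommGroup A] [InnerProductSpace ℂ A] [CompleteSpace A]
    [NormedAddCommGroup B] [InnerProductSpace ℂ B] [CompleteSpace B]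
    {Y : Type*} [MeasurableSpace Y] {n : ℕ}
    -- the initial state, the dynamics, and the auxiliary unitaries on the inaccessible part
    (Ψ : QuantumEstimation.HilbertTensor A B) (hΨ : ‖Ψ‖ = 1)
    (U : (Fin n → ℝ) → unitary
      (QuantumEstimation.HilbertTensor A B →L[ℂ] QuantumEstimation.HilbertTensor A B))
    (V : (Fin n → ℝ) → unitary (B →L[ℂ] B))
    -- the measurement on the accessible part and the estimator
    (E : QuantumEstimation.POVM Y A) (est : Y → Fin n → ℝ) (hest : Measurable est)
    -- the prior probability density
    (p : (Fin n → ℝ) → ℝ) (hp_nonneg : ∀ x, 0 ≤ p x) (hp_int : MeasureTheory.Integrable p)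
    (hp_one : ∫ x, p x = 1) (hp_diff : Differentiable ℝ p)
    -- the derivatives and integrals in the two information matrices exist
    (hρ : ∀ x, 0 < p x → DifferentiableAt ℝ (QuantumEstimation.purifiedState Ψ U V) x)
    (hF : ∀ x, 0 < p x →
      DifferentiableAt ℝ (fderiv ℝ (QuantumEstimation.purifiedFidelity Ψ U V x)) x)
    (hJQ : ∀ j k, MeasureTheory.Integrable
      fun x => p x * QuantumEstimation.fidelityHessian Ψ U V x j k)
    (hJC : ∀ j k, MeasureTheory.Integrable (QuantumEstimation.priorInfoDensity p j k))
    -- the error covariance matrix exists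
    (hMSE : ∀ j, QuantumEstimation.meanSquareError p
      (QuantumEstimation.likelihood E Ψ U) est j < ⊤) :
    (QuantumEstimation.quantumInfo p Ψ U V + QuantumEstimation.priorInfo p).PosDef ∧
    (QuantumEstimation.errorCovariance p (QuantumEstimation.likelihood E Ψ U) est -
      (QuantumEstimation.quantumInfo p Ψ U V + QuantumEstimation.priorInfo p)⁻¹).PosSemidef := by
  have hφ := norm_purifiedVector U V hΨ
  have hO : IsOpen {x | 0 < p x} := isOpen_lt continuous_const hp_diff.continuous
  have hz : ∀ x, 0 < p x →
      DifferentiableAt ℝ (overlapVector (purifiedVector Ψ U V) x) x :=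
    fun x hx => differentiableAt_overlapVector (hρ x hx)
  -- `hF` speaks of `fderiv`, which defaults to 0, so differentiability of the fidelity near `x` is
  -- drawn from that of `ρ` on the open set `{p > 0}`.
  have hd : ∀ x, 0 < p x →
      ∀ᶠ x' in nhds x, DifferentiableAt ℝ (fidelity (purifiedVector Ψ U V) x) x' := fun x hx => by
    filter_upwards [hO.mem_nhds hx] with x' hx'
    exact differentiableAt_fidelity (differentiableAt_overlapVector (hρ x' hx'))
  obtain ⟨κ, hκM, hκ⟩ := exists_kernel_outcome hp_diff hφ hz (E.tensorOne B)
  have hκL : ∀ x, 0 < p x → κ x = likelihood E Ψ U x := fun x hx => by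
    rw [hκ x hx, likelihood_eq_outcome Ψ U V]
  have hm := isProbabilityMeasure_jointMeasure (κ := κ) hp_nonneg hp_int hp_one
  set m := jointMeasure volume p κ with hmdef
  let f : Fin n → (Fin n → ℝ) × Y → ℝ := fun j z => est z.2 j - z.1 j
  have hest' : ∀ j, Measurable fun y => est y j := fun j => (measurable_pi_apply j).comp hest
  have hf : ∀ j, Measurable (f j) := fun j =>
    ((hest' j).comp measurable_snd).sub ((measurable_pi_apply j).comp measurable_fst)
  -- Finite mean-square errors put each error component in L², so the mixed products in the
  -- covariance are integrable.
  have hf2 : ∀ j, MemLp (f j) 2 m := by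
    intro j
    rw [memLp_two_iff_integrable_sq (hf j).aestronglyMeasurable]
    refine ⟨((hf j).pow_const 2).aestronglyMeasurable, ?_⟩
    rw [hasFiniteIntegral_iff_ofReal (Filter.Eventually.of_forall fun z => sq_nonneg _), hmdef,
      lintegral_jointMeasure hp_nonneg hp_diff.continuous.measurable hκL
        ((hf j).pow_const 2).ennreal_ofReal]
    exact hMSE j
  have hff : ∀ j k, Integrable (fun z => f j z * f k z) m :=
    fun j k => (hf2 j).integrable_mul (hf2 k)
  have hCov : ∀ j k, errorCovariance p (likelihood E Ψ U) est j k = ∫ z, f j z * f k z ∂m :=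
    fun j k => (integral_jointMeasure hp_nonneg hp_diff.continuous.measurable hκL (hff j k)).symm
  have hJi : ∀ j k, Integrable fun x =>
      -2 * (p x * fidelityHessian Ψ U V x j k) + priorInfoDensity p j k x := fun j k =>
    ((hJQ j k).const_mul (-2)).add (hJC j k)
  have hJ : ∀ j k, (quantumInfo p Ψ U V + priorInfo p) j k =
      ∫ x, (-2 * (p x * fidelityHessian Ψ U V x j k) + priorInfoDensity p j k x) := by
    intro j k
    rw [integral_add ((hJQ j k).const_mul (-2)) (hJC j k), integral_const_mul]
    rfl
  have hinfo : ∀ v x, infoDensity p (purifiedVector Ψ U V) v x = ∑ j, ∑ k, v j * v k *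
      (-2 * (p x * fidelityHessian Ψ U V x j k) + priorInfoDensity p j k x) := fun v x =>
    infoDensity_eq_sum hp_nonneg hp_diff hφ (hz x) (hd x) (hF x) v
  apply posDef_and_posSemidef_sub_inv
  · ext j k
    rw [Matrix.conjTranspose_apply, star_trivial, hCov, hCov]
    simp only [mul_comm]
  · ext j k
    rw [Matrix.conjTranspose_apply, star_trivial, hJ, hJ]
    refine integral_congr_ae (Filter.Eventually.of_forall fun x => ?_)
    have h : p x * fidelityHessian Ψ U V x k j = p x * fidelityHessian Ψ U V x j k := by
      rcases (hp_nonneg x).eq_or_lt with h0 | h0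
      · rw [← h0, zero_mul, zero_mul]
      · rw [fidelityHessian_comm (hd x h0) (hF x h0)]
    simp only [h, priorInfoDensity]
    ring
  · intro u v
    -- The error is tested along `u` and the parameter is displaced along an independent `v`; `l v =
    -- u ⬝ᵥ v` is the cross term.
    let l : (Fin n → ℝ) →L[ℝ] ℝ := ∑ j, u j • ContinuousLinearMap.proj j
    let b : Y → ℝ := fun y => ∑ j, u j * est y j
    have hb : Measurable b := Finset.measurable_fun_sum _ fun j _ => (hest' j).const_mul _
    have hl : ∀ x, l x = ∑ j, u j * x j := fun x => by simp [l]
    have hsq : ∀ z : (Fin n → ℝ) × Y, (b z.2 - l z.1) ^ 2 =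
        ∑ j, ∑ k, u j * u k * (f j z * f k z) := by
      intro z
      have h : b z.2 - l z.1 = ∑ j, u j * f j z := by
        simp only [b, hl, f, mul_sub, Finset.sum_sub_distrib]
      rw [h, sq, Finset.sum_mul_sum]
      exact Finset.sum_congr rfl fun _ _ => Finset.sum_congr rfl fun _ _ => by ring
    have hi2 : ∀ j, Integrable (fun z => ∑ k, u j * u k * (f j z * f k z)) m := fun j =>
      integrable_finsetSum _ fun k _ => (hff j k).const_mul _
    have hJ2 : ∀ j, Integrable fun x => ∑ k, v j * v k *
        (-2 * (p x * fidelityHessian Ψ U V x j k) + priorInfoDensity p j k x) := fun j =>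
      integrable_finsetSum _ fun k _ => (hJi j k).const_mul _
    have hQ : Integrable (infoDensity p (purifiedVector Ψ U V) v) :=
      (integrable_finsetSum _ fun j _ => hJ2 j).congr
        (Filter.Eventually.of_forall fun x => (hinfo v x).symm)
    have h := score_nonneg hp_nonneg hp_diff hp_int hφ hz (E.tensorOne B) hκ hQ l hb
      (by simp only [hsq]; exact integrable_finsetSum _ fun j _ => hi2 j)
    simp only [hsq, hinfo] at h
    rw [integral_finsetSum _ fun j _ => hi2 j, integral_finsetSum _ fun j _ => hJ2 j] at h
    simp only [integral_finsetSum _ fun k (_ : k ∈ Finset.univ) => (hff _ k).const_mul _,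
      integral_finsetSum _ fun k (_ : k ∈ Finset.univ) => (hJi _ k).const_mul _,
      integral_const_mul _ _, ← hCov, ← hJ, hl] at h
    refine h.trans_eq ?_
    simp only [dotProduct, Matrix.mulVec, Finset.mul_sum]
    refine congrArg₂ (· + ·) (congrArg₂ (· + ·) ?_ rfl) ?_
    · exact Finset.sum_congr rfl fun _ _ => Finset.sum_congr rfl fun _ _ => by ring
    · exact Finset.sum_congr rfl fun _ _ => Finset.sum_congr rfl fun _ _ => by ring
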